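/- All graphs are finite, simple and undirected. For a graph $G$ on $n$ vertices and $k\ge 2$, let $C_k(G)$ be the set of its $k$-cliques. The $k$-clique tensor $\mathcal A_k(G)=(a_{i_1\cdots i_k})$ is the tensor of order $k$ and dimension $n$ with $a_{i_1\cdots i_k}=\frac1{(k-1)!}$ if $\{i_1,\dots,i_k\}\in C_k(G)$ and $a_{i_1\cdots i_k}=0$ otherwise. A complex number $\lambda$ is an eigenvalue of it if there is a nonzero $x\in\mathbb C^n$ with $\sum_{i_2,\dots,i_k}a_{i i_2\cdots i_k}x_{i_2}\cdots x_{i_k}=\lambda x_i^{k-1}$ for all $i$, and the $k$-clique spectral radius $\mu_k(G)$ is the largest modulus of an eigenvalue of $\mathcal A_k(G)$. Let $G\vee H$ denote the join of $G$ and $H$, let $2K_r$ be the disjoint union of two copies of $K_r$, and let $T_s(m)$ be the complete $s$-partite graph on $m$ vertices whose part sizes differ pairwise by at most one; $T_0(m)$ is understood as the graph without vertices. **Corollary 1.7.** Let $r\ge 3$ and $r\le k\le 2r-1$, and let $G$ be a graph on $n$ vertices that does not contain $2K_r$ as a subgraph, where $$n\ge (2r-k-1)\left(\mathrm e\, r^4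 k^{\frac k2}\right)^{\frac{k}{2k-2r+1}}+k .$$ Then $$\mu_k(G)\le \mu_k\bigl(K_{2k-2r+1}\vee T_{2r-k-1}(n-2k+2r-1)\bigr).$$ (i) For $k=2r-1$ (where the graph on the right-hand side is $K_{2r-1}$), equality holds if and only if $|C_k(G)|=1$. (ii) For $r\le k\le 2r-2$, equality holds if and only if $G\cong K_{2k-2r+1}\vee T_{2r-k-1}(n-2k+2r-1)$. -/

import Mathlib

namespace CliqueSpectral

/-- The vector `A x^m` attached to a complex tensor `A` of order `m + 1` with indices in `V`:
its `i`-th component is `∑ A_{i j₁ … j_m} x_{j₁} ⋯ x_{j_m}`. -/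
noncomputable def tensorApply {V : Type*} [Fintype V] {m : ℕ}
    (A : (Fin (m + 1) → V) → ℂ) (x : V → ℂ) (i : V) : ℂ :=
  ∑ j : Fin m → V, A (Fin.cons i j) * ∏ l, x (j l)

/-- `z` is an eigenvalue of the tensor `A` of order `m + 1`: there is a nonzero complex vector
`x` with `A x^m = z x^[m]`. -/
def IsTensorEigenvalue {V : Type*} [Fintype V] {m : ℕ}
    (A : (Fin (m + 1) → V) → ℂ) (z : ℂ) : Prop :=
  ∃ x : V → ℂ, x ≠ 0 ∧ ∀ i, tensorApply A x i = z * x i ^ m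

/-- The spectral radius of a tensor: the largest modulus of an eigenvalue. -/
noncomputable def tensorSpectralRadius {V : Type*} [Fintype V] {m : ℕ}
    (A : (Fin (m + 1) → V) → ℂ) : ℝ :=
  sSup {t : ℝ | ∃ z : ℂ, IsTensorEigenvalue A z ∧ t = ‖z‖}

/-- The moduli of the eigenvalues of a tensor are bounded. -/
theorem bddAbove_eigenvalues {V : Type*} [Fintype V] {m : ℕ}
    (A : (Fin (m + 1) → V) → ℂ) :
    BddAbove {t : ℝ | ∃ z : ℂ, IsTensorEigenvalue A z ∧ t = ‖z‖} := by
  refine ⟨∑ i : V, ∑ j : Fin m → V, ‖A (Fin.cons i j)‖, ?_⟩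
  rintro t ⟨z, ⟨x, hx, h⟩, rfl⟩
  obtain ⟨i₀, hi₀⟩ := Function.ne_iff.mp hx
  obtain ⟨i, -, hi⟩ := Finset.exists_max_image Finset.univ (fun i => ‖x i‖) ⟨i₀, Finset.mem_univ _⟩
  have hpos : 0 < ‖x i‖ := lt_of_lt_of_le (norm_pos_iff.mpr hi₀) (hi i₀ (Finset.mem_univ _))
  have h1 : ‖z‖ * ‖x i‖ ^ m ≤ (∑ j : Fin m → V, ‖A (Fin.cons i j)‖) * ‖x i‖ ^ m := by
    rw [← norm_pow, ← norm_mul, ← h i, tensorApply, Finset.sum_mul]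
    refine (norm_sum_le _ _).trans (Finset.sum_le_sum fun j _ => ?_)
    rw [norm_mul, norm_prod, norm_pow]
    refine mul_le_mul_of_nonneg_left ?_ (norm_nonneg _)
    refine (Finset.prod_le_prod (fun l _ => norm_nonneg _)
      (fun l _ => hi (j l) (Finset.mem_univ _))).trans (by simp)
  refine (le_of_mul_le_mul_right h1 (pow_pos hpos m)).trans ?_
  exact Finset.single_le_sum (f := fun i => ∑ j : Fin m → V, ‖A (Fin.cons i j)‖)
    (fun _ _ => Finset.sum_nonneg fun _ _ => norm_nonneg _) (Finset.mem_univ i)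

open scoped Classical in
/-- The `r`-clique tensor of `G`, for `r ≥ 1` (so that its order `r - 1 + 1` is `r`): the entry at
`(i₁, …, i_r)` is `1 / (r - 1)!` if `{i₁, …, i_r}` is an `r`-clique of `G`, and `0` otherwise. -/
noncomputable def cliqueTensor {V : Type*} (G : SimpleGraph V) (r : ℕ) :
    (Fin (r - 1 + 1) → V) → ℂ :=
  fun i => if G.IsNClique r (Finset.univ.image i) then 1 / ((r - 1).factorial : ℂ) else 0

/-- The `r`-clique spectral radius `μ_r(G)`. -/
noncomputable def cliqueSpectralRadius {V : Type*} [Fintype V] (r : ℕ) (G : SimpleGraph V) : ℝ :=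
  tensorSpectralRadius (cliqueTensor G r)

/-- The join `G ∨ H`: the disjoint union of `G` and `H` with all edges between them added. -/
def graphJoin {V W : Type*} (G : SimpleGraph V) (H : SimpleGraph W) : SimpleGraph (V ⊕ W) :=
  (G ⊕g H) ⊔ completeBipartiteGraph V W

/-- The Turán graph `T_s(m)`: the complete `s`-partite graph whose parts have the sizes
`⌊(m + i) / s⌋` for `0 ≤ i < s`, which differ by at most one and add up to `m`
(`card_turan` below). By convention `T_0(m)`, having no parts, is the graph without vertices. -/
def turan (s m : ℕ) : SimpleGraph (Σ i : Fin s, Fin ((m + i) / s)) :=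
  SimpleGraph.completeMultipartiteGraph fun i : Fin s => Fin ((m + i) / s)

theorem card_turan (s m : ℕ) (hs : 0 < s) :
    Fintype.card (Σ i : Fin s, Fin ((m + i) / s)) = m := by
  simp only [Fintype.card_sigma, Fintype.card_fin]
  rw [Fin.sum_univ_eq_sum_range (fun i => (m + i) / s) s]
  induction m with
  | zero =>
    refine Finset.sum_eq_zero fun i hi => ?_
    rw [Nat.zero_add, Nat.div_eq_of_lt (Finset.mem_range.mp hi)]
  | succ m ih =>
    have h1 := Finset.sum_range_succ (fun i => (m + i) / s) s
    have h2 := Finset.sum_range_succ' (fun i => (m + i) / s) s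
    have h3 : (m + s) / s = m / s + 1 := Nat.add_div_right m hs
    have h4 : ∑ i ∈ Finset.range s, (m + 1 + i) / s
        = ∑ i ∈ Finset.range s, (m + (i + 1)) / s :=
      Finset.sum_congr rfl fun i _ => by rw [Nat.add_assoc, Nat.add_comm 1 i]
    simp only [Nat.add_zero] at h2
    omega

/-- The graph `K_{2k-2r+1} ∨ T_{2r-k-1}(n-2k+2r-1)`, for `r ≤ k ≤ 2r - 1` and `k ≤ n` (then no
subtraction is truncated). For `k = 2r - 1` it is `K_{2r-1}`. -/
def extremalGraph (n r k : ℕ) :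
    SimpleGraph (Fin (2 * k - 2 * r + 1) ⊕
      (Σ i : Fin (2 * r - k - 1), Fin ((n - (2 * k - 2 * r + 1) + i) / (2 * r - k - 1)))) :=
  graphJoin (SimpleGraph.completeGraph (Fin (2 * k - 2 * r + 1)))
    (turan (2 * r - k - 1) (n - (2 * k - 2 * r + 1)))

/-- The graph `2K_r`, the disjoint union of two copies of `K_r`. -/
def twoCliques (r : ℕ) : SimpleGraph (Fin r ⊕ Fin r) :=
  SimpleGraph.completeGraph (Fin r) ⊕g SimpleGraph.completeGraph (Fin r)

end CliqueSpectral

namespace CliqueSpectral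

open Finset

section CliquePolynomial

open scoped Classical

variable {V : Type*} (G : SimpleGraph V)

/-- The cliques of `G` with `s` vertices, all of them in `S`. -/
noncomputable def cliquesIn (S : Finset V) (s : ℕ) : Finset (Finset V) :=
  (S.powersetCard s).filter fun C => G.IsClique C

/-- The sum of the monomials `∏ v ∈ C, y v` over the cliques `C ⊆ S` with `s` vertices. -/
noncomputable def cliquePoly {R : Type*} [CommSemiring R] (S : Finset V) (s : ℕ) (y : V → R) : R :=
  ∑ C ∈ cliquesIn G S s, ∏ v ∈ C, y v

variable {G}

theorem mem_cliquesIn {S C : Finset V} {s : ℕ} :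
    C ∈ cliquesIn G S s ↔ C ⊆ S ∧ C.card = s ∧ G.IsClique C := by
  simp [cliquesIn, and_assoc]

theorem cliquePoly_nonneg {S : Finset V} {s : ℕ} {y : V → ℝ} (hy : ∀ v, 0 ≤ y v) :
    0 ≤ cliquePoly G S s y :=
  sum_nonneg fun _ _ => prod_nonneg fun v _ => hy v

theorem cliquesIn_zero (S : Finset V) : cliquesIn G S 0 = {∅} := by
  ext C
  simp only [mem_cliquesIn, card_eq_zero, mem_singleton]
  constructor
  · exact fun h => h.2.1
  · rintro rfl
    simp

theorem cliquePoly_zero {R : Type*} [CommSemiring R] (S : Finset V) (y : V → R) :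
    cliquePoly G S 0 y = 1 := by
  simp [cliquePoly, cliquesIn_zero]

theorem mul_cliquePoly_neighbors {R : Type*} [CommSemiring R] (S : Finset V) (s : ℕ) (y : V → R)
    {v : V} (hv : v ∈ S) :
    y v * cliquePoly G (S.filter (G.Adj v)) s y =
      ∑ C ∈ (cliquesIn G S (s + 1)).filter (v ∈ ·), ∏ w ∈ C, y w := by
  rw [cliquePoly, mul_sum]
  have hnot : ∀ D ∈ cliquesIn G (S.filter (G.Adj v)) s, v ∉ D := by
    intro D hD hvD
    have := (mem_cliquesIn.1 hD).1 hvD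
    simp at this
  refine sum_bij' (fun D _ => insert v D) (fun C _ => C.erase v) ?_ ?_ ?_ ?_ ?_
  · intro D hD
    have hvD := hnot D hD
    rw [mem_cliquesIn] at hD
    simp only [mem_filter, mem_cliquesIn, mem_insert, true_or, and_true, card_insert_of_notMem hvD,
      hD.2.1, true_and, coe_insert]
    refine ⟨insert_subset hv (hD.1.trans (filter_subset _ _)), ?_⟩
    exact hD.2.2.insert fun b hb _ => (mem_filter.1 (hD.1 hb)).2
  · intro C hC
    simp only [mem_filter, mem_cliquesIn] at hC
    obtain ⟨⟨hCS, hcard, hcl⟩, hvC⟩ := hC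
    rw [mem_cliquesIn]
    refine ⟨fun w hw => ?_, by rw [card_erase_of_mem hvC, hcard]; rfl,
      hcl.subset (by simp)⟩
    rw [mem_erase] at hw
    exact mem_filter.2 ⟨hCS hw.2, hcl hvC hw.2 (Ne.symm hw.1)⟩
  · intro D hD
    exact erase_insert (hnot D hD)
  · intro C hC
    exact insert_erase (mem_filter.1 hC).2
  · intro D hD
    rw [prod_insert (hnot D hD)]

theorem sum_mul_cliquePoly_neighbors {R : Type*} [CommSemiring R] (S A : Finset V) (hA : A ⊆ S)
    (s : ℕ) (y : V → R) :
    ∑ v ∈ A, y v * cliquePoly G (S.filter (G.Adj v)) s y =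
      ∑ C ∈ cliquesIn G S (s + 1), ((A ∩ C).card : R) * ∏ w ∈ C, y w := by
  rw [sum_congr rfl fun v hv => mul_cliquePoly_neighbors S s y (hA hv)]
  simp_rw [sum_filter]
  rw [sum_comm]
  refine sum_congr rfl fun C _ => ?_
  rw [← sum_filter, sum_const, nsmul_eq_mul, filter_mem_eq_inter]

/-- A weighted Turán inequality, with its case of equality: the clique polynomial of a graph
without `(s + 1)`-cliques is at most that of some complete `s`-partite graph. -/
theorem exists_coloring_cliquePoly_le {y : V → ℝ} (hy : ∀ v, 0 ≤ y v) (s : ℕ) (S : Finset V)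
    (hfree : cliquesIn G S (s + 1) = ∅) :
    ∃ c : V → ℕ, (∀ v ∈ S, c v < s) ∧
      cliquePoly G S s y ≤ ∏ j ∈ range s, ∑ v ∈ S.filter (c · = j), y v ∧
      ((∀ v ∈ S, 0 < y v) → 0 < cliquePoly G S s y →
        cliquePoly G S s y = ∏ j ∈ range s, ∑ v ∈ S.filter (c · = j), y v →
        ∀ a ∈ S, ∀ b ∈ S, G.Adj a b ↔ c a ≠ c b) := by
  induction s generalizing S with
  | zero =>
    have hS : ∀ v, v ∉ S := by
      intro v hv
      have : ({v} : Finset V) ∈ cliquesIn G S 1 := by simp [mem_cliquesIn, hv]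
      rw [hfree] at this
      simp at this
    exact ⟨fun _ => 0, fun v hv => absurd hv (hS v), by simp [cliquePoly_zero],
      fun _ _ _ a ha => absurd ha (hS a)⟩
  | succ s ih =>
    rcases S.eq_empty_or_nonempty with rfl | hne
    · have h0 : cliquesIn G ∅ (s + 1) = ∅ := by
        rw [cliquesIn, powersetCard_eq_empty.2 (by simp), filter_empty]
      exact ⟨fun _ => 0, by simp, by simp [cliquePoly, h0], by simp⟩
    obtain ⟨u, hu, hmax⟩ := exists_max_image S
      (fun v => cliquePoly G (S.filter (G.Adj v)) s y) hne
    set S' := S.filter (G.Adj u) with hS'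
    set A := S.filter (fun v => ¬ G.Adj u v) with hA
    have hfree' : cliquesIn G S' (s + 1) = ∅ := by
      refine eq_empty_of_forall_notMem fun D hD => ?_
      rw [mem_cliquesIn] at hD
      have huD : u ∉ D := fun h => by simpa [hS'] using hD.1 h
      have : insert u D ∈ cliquesIn G S (s + 1 + 1) := by
        rw [mem_cliquesIn, card_insert_of_notMem huD, hD.2.1, coe_insert]
        exact ⟨insert_subset hu (hD.1.trans (filter_subset _ _)), rfl,
          hD.2.2.insert fun b hb _ => (mem_filter.1 (hD.1 hb)).2⟩
      rw [hfree] at this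
      simp at this
    obtain ⟨c', hc's, hc'le, hc'eq⟩ := ih S' hfree'
    let c : V → ℕ := fun v => if G.Adj u v then c' v else s
    have hparts : ∀ j ∈ range s, S.filter (c · = j) = S'.filter (c' · = j) := by
      intro j hj
      rw [mem_range] at hj
      ext v
      simp only [mem_filter, hS', c]
      by_cases h : G.Adj u v
      · simp [h]
      · simp [h, hj.ne']
    have hlast : S.filter (c · = s) = A := by
      ext v
      simp only [mem_filter, hA, c]
      by_cases h : G.Adj u v
      · simp only [h, if_true, not_true, and_false, iff_false, not_and]
        exact fun hv => (hc's v (mem_filter.2 ⟨hv, h⟩)).ne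
      · simp [h]
    have hprod : ∏ j ∈ range (s + 1), ∑ v ∈ S.filter (c · = j), y v =
        (∑ v ∈ A, y v) * ∏ j ∈ range s, ∑ v ∈ S'.filter (c' · = j), y v := by
      rw [prod_range_succ, hlast, mul_comm]
      congr 1
      exact prod_congr rfl fun j hj => by rw [hparts j hj]
    have hsum := sum_mul_cliquePoly_neighbors (G := G) S A (filter_subset _ _) s y
    have hhit : ∀ C ∈ cliquesIn G S (s + 1), 1 ≤ (A ∩ C).card := by
      intro C hC
      rw [Nat.one_le_iff_ne_zero, Ne, card_eq_zero]
      intro h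
      have hC' := mem_cliquesIn.1 hC
      have : C ∈ cliquesIn G S' (s + 1) := by
        refine mem_cliquesIn.2 ⟨fun v hv => ?_, hC'.2⟩
        by_contra hv'
        have : v ∈ A ∩ C := mem_inter.2 ⟨mem_filter.2 ⟨hC'.1 hv, fun h =>
          hv' (mem_filter.2 ⟨hC'.1 hv, h⟩)⟩, hv⟩
        rw [h] at this
        simp at this
      rw [hfree'] at this
      simp at this
    have hterm : ∀ C ∈ cliquesIn G S (s + 1),
        ∏ w ∈ C, y w ≤ ((A ∩ C).card : ℝ) * ∏ w ∈ C, y w := fun C hC =>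
      le_mul_of_one_le_left (prod_nonneg fun v _ => hy v) (by exact_mod_cast hhit C hC)
    have h1 : cliquePoly G S (s + 1) y ≤
        ∑ v ∈ A, y v * cliquePoly G (S.filter (G.Adj v)) s y := by
      rw [hsum]
      exact sum_le_sum hterm
    have hterm2 : ∀ v ∈ A, y v * cliquePoly G (S.filter (G.Adj v)) s y ≤
        y v * cliquePoly G S' s y := fun v hv =>
      mul_le_mul_of_nonneg_left (hmax v (mem_filter.1 hv).1) (hy v)
    have h2 : ∑ v ∈ A, y v * cliquePoly G (S.filter (G.Adj v)) s y ≤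
        (∑ v ∈ A, y v) * cliquePoly G S' s y := by
      rw [sum_mul]
      exact sum_le_sum hterm2
    have hX : 0 ≤ ∑ v ∈ A, y v := sum_nonneg fun v _ => hy v
    have h3 := mul_le_mul_of_nonneg_left hc'le hX
    refine ⟨c, ?_, ?_, ?_⟩
    · intro v hv
      simp only [c]
      split_ifs with h
      · exact (hc's v (mem_filter.2 ⟨hv, h⟩)).trans (Nat.lt_succ_self s)
      · exact Nat.lt_succ_self s
    · rw [hprod]
      exact h1.trans (h2.trans h3)
    · intro hpos hP heq
      rw [hprod] at heq
      have e1 : cliquePoly G S (s + 1) y =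
          ∑ v ∈ A, y v * cliquePoly G (S.filter (G.Adj v)) s y := by linarith
      have e2 : ∑ v ∈ A, y v * cliquePoly G (S.filter (G.Adj v)) s y =
          (∑ v ∈ A, y v) * cliquePoly G S' s y := by linarith
      have e3 : (∑ v ∈ A, y v) * cliquePoly G S' s y =
          (∑ v ∈ A, y v) * ∏ j ∈ range s, ∑ v ∈ S'.filter (c' · = j), y v := by linarith
      have hprodpos : 0 < (∑ v ∈ A, y v) * cliquePoly G S' s y := by linarith
      have hXpos : 0 < ∑ v ∈ A, y v := pos_of_mul_pos_left hprodpos (cliquePoly_nonneg hy)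
      have hLpos : 0 < cliquePoly G S' s y := pos_of_mul_pos_right hprodpos hX
      have e4 := mul_left_cancel₀ hXpos.ne' e3
      have hadj' := hc'eq (fun v hv => hpos v (mem_filter.1 hv).1) hLpos e4
      have hone : ∀ C ∈ cliquesIn G S (s + 1), (A ∩ C).card = 1 := by
        intro C hC
        rw [hsum] at e1
        have := (sum_eq_sum_iff_of_le hterm).1 e1 C hC
        have hCpos : 0 < ∏ w ∈ C, y w := prod_pos fun w hw => hpos w ((mem_cliquesIn.1 hC).1 hw)
        have h' : ((A ∩ C).card : ℝ) = 1 := by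
          apply mul_right_cancel₀ hCpos.ne'
          rw [one_mul]
          exact this.symm
        exact_mod_cast h'
      have hLeq : ∀ v ∈ A, cliquePoly G (S.filter (G.Adj v)) s y = cliquePoly G S' s y := by
        intro v hv
        rw [sum_mul] at e2
        exact mul_left_cancel₀ (hpos v (mem_filter.1 hv).1).ne'
          ((sum_eq_sum_iff_of_le hterm2).1 e2 v hv)
      have hsub : ∀ v ∈ A, cliquesIn G (S.filter (G.Adj v)) s ⊆ cliquesIn G S' s := by
        intro v hv D hD
        have hD' := mem_cliquesIn.1 hD
        refine mem_cliquesIn.2 ⟨fun w hw => ?_, hD'.2⟩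
        by_contra hw'
        have hvD : v ∉ D := fun h => by simpa using hD'.1 h
        have hins : insert v D ∈ cliquesIn G S (s + 1) := by
          rw [mem_cliquesIn, card_insert_of_notMem hvD, hD'.2.1, coe_insert]
          exact ⟨insert_subset (mem_filter.1 hv).1 (hD'.1.trans (filter_subset _ _)), rfl,
            hD'.2.2.insert fun b hb _ => (mem_filter.1 (hD'.1 hb)).2⟩
        have hwS := (mem_filter.1 (hD'.1 hw)).1
        obtain ⟨z, hz⟩ := card_eq_one.1 (hone _ hins)
        have hv1 : v ∈ A ∩ insert v D := by simp [hv]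
        have hw1 : w ∈ A ∩ insert v D := mem_inter.2
          ⟨mem_filter.2 ⟨hwS, fun h => hw' (mem_filter.2 ⟨hwS, h⟩)⟩, mem_insert_of_mem hw⟩
        rw [hz, mem_singleton] at hv1 hw1
        exact hvD (hv1.trans hw1.symm ▸ hw)
      have hall : ∀ v ∈ A, ∀ D ∈ cliquesIn G S' s, ∀ w ∈ D, G.Adj v w := by
        intro v hv D hD w hw
        by_contra hvw
        have hDn : D ∉ cliquesIn G (S.filter (G.Adj v)) s := fun h =>
          hvw (mem_filter.1 ((mem_cliquesIn.1 h).1 hw)).2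
        have := sum_lt_sum_of_subset (hsub v hv) hD hDn
          (f := fun D => ∏ w ∈ D, y w)
          (prod_pos fun w hw => hpos w (mem_filter.1 ((mem_cliquesIn.1 hD).1 hw)).1)
          (fun _ _ _ => prod_nonneg fun w _ => hy w)
        exact this.ne (hLeq v hv)
      have hclique : ∀ w ∈ S', ∃ D ∈ cliquesIn G S' s, w ∈ D := by
        intro w hw
        have hex : ∀ j, ∃ v, j ∈ range s → v ∈ S' ∧ c' v = j := by
          intro j
          by_cases hj : j ∈ range s
          · rw [e4] at hLpos
            have hne := prod_ne_zero_iff.1 hLpos.ne' j hj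
            obtain ⟨v, hv, -⟩ := exists_ne_zero_of_sum_ne_zero hne
            exact ⟨v, fun _ => mem_filter.1 hv⟩
          · exact ⟨w, fun h => absurd h hj⟩
        choose f hf using hex
        let g : ℕ → V := Function.update f (c' w) w
        have hg : ∀ j ∈ range s, g j ∈ S' ∧ c' (g j) = j := by
          intro j hj
          simp only [g, Function.update_apply]
          split_ifs with h
          · exact ⟨hw, h.symm⟩
          · exact hf j hj
        refine ⟨(range s).image g, mem_cliquesIn.2 ⟨?_, ?_, ?_⟩, ?_⟩
        · exact image_subset_iff.2 fun j hj => (hg j hj).1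
        · rw [card_image_of_injOn, card_range]
          intro i hi j hj hij
          rw [← (hg i hi).2, ← (hg j hj).2, hij]
        · intro a ha b hb hab
          simp only [coe_image, Set.mem_image, mem_coe] at ha hb
          obtain ⟨i, hi, rfl⟩ := ha
          obtain ⟨j, hj, rfl⟩ := hb
          rw [hadj' _ (hg i hi).1 _ (hg j hj).1, (hg i hi).2, (hg j hj).2]
          rintro rfl
          exact hab rfl
        · exact mem_image.2 ⟨c' w, mem_range.2 (hc's w hw), by simp [g]⟩
      have hjoin : ∀ v ∈ A, ∀ w ∈ S', G.Adj v w := by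
        intro v hv w hw
        obtain ⟨D, hD, hwD⟩ := hclique w hw
        exact hall v hv D hD w hwD
      have hindep : ∀ v ∈ A, ∀ w ∈ A, ¬ G.Adj v w := by
        intro v hv w hw hvw
        obtain ⟨D, hD, -⟩ := exists_ne_zero_of_sum_ne_zero hLpos.ne'
        have hDw : insert w D ∈ cliquesIn G S (s + 1) := by
          have hD' := mem_cliquesIn.1 hD
          have hwD : w ∉ D := fun h => (mem_filter.1 hw).2 (mem_filter.1 (hD'.1 h)).2
          rw [mem_cliquesIn, card_insert_of_notMem hwD, hD'.2.1, coe_insert]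
          exact ⟨insert_subset (mem_filter.1 hw).1 (hD'.1.trans (filter_subset _ _)), rfl,
            hD'.2.2.insert fun b hb _ => hall w hw D hD b hb⟩
        have hD' := mem_cliquesIn.1 hDw
        have hvD : v ∉ insert w D := by
          rw [mem_insert]
          rintro (h | h)
          · exact hvw.ne h
          · exact (mem_filter.1 hv).2 (mem_filter.1 ((mem_cliquesIn.1 hD).1 h)).2
        have : insert v (insert w D) ∈ cliquesIn G S (s + 1 + 1) := by
          rw [mem_cliquesIn, card_insert_of_notMem hvD, hD'.2.1, coe_insert]
          refine ⟨insert_subset (mem_filter.1 hv).1 hD'.1, rfl, hD'.2.2.insert fun b hb _ => ?_⟩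
          rcases mem_insert.1 (mem_coe.1 hb) with rfl | hb
          · exact hvw
          · exact hall v hv D hD b hb
        rw [hfree] at this
        simp at this
      intro a ha b hb
      by_cases hua : G.Adj u a <;> by_cases hub : G.Adj u b <;>
        simp only [c, hua, hub, if_true, if_false]
      · exact hadj' a (mem_filter.2 ⟨ha, hua⟩) b (mem_filter.2 ⟨hb, hub⟩)
      · have ha' : a ∈ S' := mem_filter.2 ⟨ha, hua⟩
        exact iff_of_true (hjoin b (mem_filter.2 ⟨hb, hub⟩) a ha').symm (hc's a ha').ne
      · have hb' : b ∈ S' := mem_filter.2 ⟨hb, hub⟩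
        exact iff_of_true (hjoin a (mem_filter.2 ⟨ha, hua⟩) b hb') (hc's b hb').ne'
      · exact iff_of_false (hindep a (mem_filter.2 ⟨ha, hua⟩) b (mem_filter.2 ⟨hb, hub⟩))
          (by simp)

end CliquePolynomial

section Eigenvalues

open scoped Classical

variable {V : Type*} [Fintype V] {G : SimpleGraph V}

theorem card_filter_image_eq (D : Finset V) :
    ((univ : Finset (Fin D.card → V)).filter fun j => univ.image j = D).card =
      D.card.factorial := by
  have h : Fintype.card (Fin D.card ≃ D) = D.card.factorial := by
    rw [Fintype.card_equiv D.equivFin.symm, Fintype.card_fin]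
  rw [← h, ← card_univ]
  symm
  refine card_bij (fun e _ l => (e l : V)) ?_ ?_ ?_
  · intro e _
    simp only [mem_filter, mem_univ, true_and]
    ext v
    simp only [mem_image, mem_univ, true_and]
    constructor
    · rintro ⟨l, rfl⟩
      exact (e l).2
    · exact fun hv => ⟨e.symm ⟨v, hv⟩, by simp⟩
  · intro e _ e' _ h
    ext l
    exact congrFun h l
  · intro j hj
    simp only [mem_filter, mem_univ, true_and] at hj
    have hm : ∀ l, j l ∈ D := fun l => hj ▸ mem_image_of_mem j (mem_univ l)
    have hs : Function.Surjective fun l => (⟨j l, hm l⟩ : D) := by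
      rintro ⟨v, hv⟩
      rw [← hj] at hv
      obtain ⟨l, -, hl⟩ := mem_image.1 hv
      exact ⟨l, Subtype.ext hl⟩
    have hb := (Fintype.bijective_iff_surjective_and_card _).2 ⟨hs, by simp⟩
    exact ⟨Equiv.ofBijective _ hb, mem_univ _, rfl⟩

theorem image_cons_eq {V : Type*} {m : ℕ} (i : V) (j : Fin m → V) :
    (univ : Finset (Fin (m + 1))).image (Fin.cons i j : Fin (m + 1) → V) =
      insert i (univ.image j) := by
  ext v
  simp [Fin.exists_fin_succ, eq_comm]

theorem isNClique_image_cons_iff {m : ℕ} (i : V) (j : Fin m → V) :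
    G.IsNClique (m + 1) ((univ : Finset (Fin (m + 1))).image (Fin.cons i j : Fin (m + 1) → V)) ↔
      univ.image j ∈ cliquesIn G (univ.filter (G.Adj i)) m := by
  rw [image_cons_eq, SimpleGraph.isNClique_iff, mem_cliquesIn]
  have hle : (univ.image j).card ≤ m := card_image_le.trans (by simp)
  constructor
  · rintro ⟨hcl, hcard⟩
    have hi : i ∉ univ.image j := by
      intro hi
      rw [insert_eq_of_mem hi] at hcard
      omega
    rw [card_insert_of_notMem hi] at hcard
    refine ⟨fun v hv => ?_, by omega, hcl.subset (by simp)⟩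
    rw [mem_filter]
    refine ⟨mem_univ _, hcl (by simp) (mem_coe.2 (mem_insert_of_mem hv)) ?_⟩
    rintro rfl
    exact hi hv
  · rintro ⟨hsub, hcard, hcl⟩
    have hi : i ∉ univ.image j := fun h => by simpa using hsub h
    rw [card_insert_of_notMem hi, hcard, coe_insert]
    exact ⟨hcl.insert fun b hb _ => (mem_filter.1 (hsub hb)).2, rfl⟩

theorem tensorApply_cliqueTensor (m : ℕ) (x : V → ℂ) (i : V) :
    tensorApply (cliqueTensor G (m + 1)) x i = cliquePoly G (univ.filter (G.Adj i)) m x := by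
  have hm : (m.factorial : ℂ) ≠ 0 := by exact_mod_cast m.factorial_ne_zero
  have h1 : tensorApply (cliqueTensor G (m + 1)) x i =
      ∑ j ∈ (univ : Finset (Fin m → V)).filter
        (fun j => univ.image j ∈ cliquesIn G (univ.filter (G.Adj i)) m),
          (1 / (m.factorial : ℂ)) * ∏ l, x (j l) := by
    rw [sum_filter]
    refine sum_congr rfl fun j _ => ?_
    simp only [cliqueTensor]
    have := isNClique_image_cons_iff (G := G) i j
    by_cases h : univ.image j ∈ cliquesIn G (univ.filter (G.Adj i)) m
    · rw [if_pos h]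
      have h' := this.2 h
      congr 1
      exact if_pos h'
    · rw [if_neg h]
      have h' := mt this.1 h
      refine mul_eq_zero_of_left ?_ _
      exact if_neg h'
  rw [h1, cliquePoly, ← sum_fiberwise_of_maps_to (g := fun j : Fin m → V => univ.image j)
    (t := cliquesIn G (univ.filter (G.Adj i)) m) (fun j hj => (mem_filter.1 hj).2)]
  refine sum_congr rfl fun D hD => ?_
  obtain ⟨-, rfl, -⟩ := mem_cliquesIn.1 hD
  have hset : (filter (fun j : Fin D.card → V => univ.image j = D)
      (univ.filter fun j : Fin D.card → V =>
        univ.image j ∈ cliquesIn G (univ.filter (G.Adj i)) D.card)) =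
      univ.filter fun j : Fin D.card → V => univ.image j = D := by
    ext j
    simp only [mem_filter, mem_univ, true_and, and_iff_right_iff_imp]
    rintro h
    rwa [h]
  rw [hset]
  have hval : ∀ j ∈ univ.filter (fun j : Fin D.card → V => univ.image j = D),
      (1 / (D.card.factorial : ℂ)) * ∏ l, x (j l) =
        (1 / (D.card.factorial : ℂ)) * ∏ v ∈ D, x v := by
    intro j hj
    have hj' := (mem_filter.1 hj).2
    have hinj : Function.Injective j := by
      rw [← Set.injOn_univ, ← coe_univ, ← card_image_iff, hj', card_univ, Fintype.card_fin]
    have hD := prod_image (s := univ) (f := x) (g := j) fun a _ b _ h => hinj h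
    rw [hj'] at hD
    rw [hD]
  rw [sum_congr rfl hval, sum_const, card_filter_image_eq, nsmul_eq_mul]
  field_simp

theorem norm_cliquePoly_le {V : Type*} {G : SimpleGraph V} (S : Finset V) (s : ℕ) (x : V → ℂ) :
    ‖cliquePoly G S s x‖ ≤ cliquePoly G S s (fun v => ‖x v‖) := by
  refine (norm_sum_le _ _).trans (sum_le_sum fun C _ => ?_)
  rw [norm_prod]

theorem sum_mul_cliquePoly_univ (m : ℕ) (y : V → ℝ) :
    ∑ v, y v * cliquePoly G (univ.filter (G.Adj v)) m y =
      (m + 1) * cliquePoly G univ (m + 1) y := by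
  rw [sum_mul_cliquePoly_neighbors univ univ subset_rfl, cliquePoly, mul_sum]
  refine sum_congr rfl fun C hC => ?_
  rw [univ_inter, (mem_cliquesIn.1 hC).2.1]
  push_cast
  rfl

/-- An eigenvalue is bounded by the value of the Rayleigh quotient at the moduli of the entries of
an eigenvector. -/
theorem exists_weights_of_isTensorEigenvalue {k : ℕ} (hk : 1 ≤ k) {z : ℂ}
    (hz : IsTensorEigenvalue (cliqueTensor G k) z) :
    ∃ y : V → ℝ, (∀ v, 0 ≤ y v) ∧ 0 < ∑ v, y v ^ k ∧
      ‖z‖ * ∑ v, y v ^ k ≤ k * cliquePoly G univ k y := by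
  obtain ⟨m, rfl⟩ : ∃ m, k = m + 1 := ⟨k - 1, by omega⟩
  obtain ⟨x, hx, h⟩ := hz
  obtain ⟨i₀, hi₀⟩ := Function.ne_iff.mp hx
  refine ⟨fun v => ‖x v‖, fun v => norm_nonneg _, ?_, ?_⟩
  · exact sum_pos' (fun v _ => by positivity)
      ⟨i₀, mem_univ _, pow_pos (norm_pos_iff.2 hi₀) _⟩
  · have := sum_mul_cliquePoly_univ (G := G) m (fun v => ‖x v‖)
    push_cast
    rw [← this, mul_sum]
    refine sum_le_sum fun v _ => ?_
    have hv := h v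
    rw [tensorApply_cliqueTensor] at hv
    have h2 := norm_cliquePoly_le (G := G) (univ.filter (G.Adj v)) m x
    rw [hv, norm_mul, norm_pow] at h2
    calc ‖z‖ * ‖x v‖ ^ (m + 1) = ‖x v‖ * (‖z‖ * ‖x v‖ ^ m) := by ring
      _ ≤ _ := mul_le_mul_of_nonneg_left h2 (norm_nonneg _)

theorem le_cliqueSpectralRadius {k : ℕ} {z : ℂ} (hz : IsTensorEigenvalue (cliqueTensor G k) z) :
    ‖z‖ ≤ cliqueSpectralRadius k G :=
  le_csSup (bddAbove_eigenvalues _) ⟨z, hz, rfl⟩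

theorem cliqueSpectralRadius_nonneg (k : ℕ) : 0 ≤ cliqueSpectralRadius k G := by
  refine Real.sSup_nonneg ?_
  rintro t ⟨z, -, rfl⟩
  exact norm_nonneg z

theorem tensorApply_smul {m : ℕ} (A : (Fin (m + 1) → V) → ℂ) (a : ℂ) (x : V → ℂ) (i : V) :
    tensorApply A (a • x) i = a ^ m * tensorApply A x i := by
  simp only [tensorApply, mul_sum, Pi.smul_apply, smul_eq_mul, prod_mul_distrib, prod_const,
    card_univ, Fintype.card_fin]
  refine sum_congr rfl fun j _ => ?_
  ring

/-- The spectral radius of a tensor is attained, as soon as the tensor has an eigenvalue. -/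
theorem exists_norm_eq_tensorSpectralRadius {m : ℕ} (A : (Fin (m + 1) → V) → ℂ)
    (h : ∃ z, IsTensorEigenvalue A z) :
    ∃ z, IsTensorEigenvalue A z ∧ ‖z‖ = tensorSpectralRadius A := by
  let K : Set (ℂ × (V → ℂ)) :=
    {p | ‖p.1‖ ≤ tensorSpectralRadius A ∧ ‖p.2‖ = 1 ∧ ∀ i, tensorApply A p.2 i = p.1 * p.2 i ^ m}
  have hclosed : IsClosed K := by
    have h1 : IsClosed {p : ℂ × (V → ℂ) | ‖p.1‖ ≤ tensorSpectralRadius A} :=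
      isClosed_le (by fun_prop) (by fun_prop)
    have h2 : IsClosed {p : ℂ × (V → ℂ) | ‖p.2‖ = 1} :=
      isClosed_eq (by fun_prop) (by fun_prop)
    have h3 : IsClosed (⋂ i, {p : ℂ × (V → ℂ) | tensorApply A p.2 i = p.1 * p.2 i ^ m}) := by
      refine isClosed_iInter fun i => isClosed_eq ?_ (by fun_prop)
      unfold tensorApply
      fun_prop
    convert h1.inter (h2.inter h3) using 1
    ext p
    simp [K]
  have hbdd : Bornology.IsBounded K := by
    refine (Metric.isBounded_closedBall (x := (0 : ℂ × (V → ℂ)))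
      (r := max (tensorSpectralRadius A) 1)).subset ?_
    rintro ⟨z, x⟩ ⟨h1, h2, -⟩
    rw [mem_closedBall_zero_iff, Prod.norm_def]
    exact max_le_max h1 h2.le
  have hcomp : IsCompact K := Metric.isCompact_of_isClosed_isBounded hclosed hbdd
  have himage : (fun p : ℂ × (V → ℂ) => ‖p.1‖) '' K =
      {t : ℝ | ∃ z : ℂ, IsTensorEigenvalue A z ∧ t = ‖z‖} := by
    ext t
    constructor
    · rintro ⟨⟨z, x⟩, ⟨-, h2, h3⟩, rfl⟩
      refine ⟨z, ⟨x, ?_, h3⟩, rfl⟩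
      rintro rfl
      simp at h2
    · rintro ⟨z, ⟨x, hx, hxz⟩, rfl⟩
      have hx0 : ‖x‖ ≠ 0 := norm_ne_zero_iff.2 hx
      refine ⟨⟨z, ((‖x‖⁻¹ : ℝ) : ℂ) • x⟩, ⟨?_, ?_, fun i => ?_⟩, rfl⟩
      · exact le_csSup (bddAbove_eigenvalues A) ⟨z, ⟨x, hx, hxz⟩, rfl⟩
      · simp [norm_smul, hx0]
      · simp only
        rw [tensorApply_smul, hxz, Pi.smul_apply, smul_eq_mul, mul_pow]
        ring
  have hne : {t : ℝ | ∃ z : ℂ, IsTensorEigenvalue A z ∧ t = ‖z‖}.Nonempty := by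
    obtain ⟨z, hz⟩ := h
    exact ⟨_, z, hz, rfl⟩
  obtain ⟨z, hz, hzt⟩ := (himage ▸ hcomp.image (by fun_prop) : IsCompact
    {t : ℝ | ∃ z : ℂ, IsTensorEigenvalue A z ∧ t = ‖z‖}).sSup_mem hne
  exact ⟨z, hz, hzt.symm⟩

theorem exists_eigenvalue_of_cliqueSpectralRadius_pos {k : ℕ} (h : 0 < cliqueSpectralRadius k G) :
    ∃ z, IsTensorEigenvalue (cliqueTensor G k) z ∧ ‖z‖ = cliqueSpectralRadius k G := by
  refine exists_norm_eq_tensorSpectralRadius _ ?_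
  by_contra hne
  have : {t : ℝ | ∃ z : ℂ, IsTensorEigenvalue (cliqueTensor G k) z ∧ t = ‖z‖} = ∅ := by
    ext t
    refine iff_of_false ?_ (Set.notMem_empty t)
    rintro ⟨z, hz, -⟩
    exact hne ⟨z, hz⟩
  rw [cliqueSpectralRadius, tensorSpectralRadius, this, Real.sSup_empty] at h
  exact lt_irrefl _ h

theorem isTensorEigenvalue_of_iso {W : Type*} [Fintype W] {H : SimpleGraph W} (e : G ≃g H)
    {k : ℕ} {z : ℂ} (hz : IsTensorEigenvalue (cliqueTensor G k) z) :
    IsTensorEigenvalue (cliqueTensor H k) z := by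
  obtain ⟨x, hx, h⟩ := hz
  refine ⟨x ∘ e.symm, ?_, fun i => ?_⟩
  · intro h0
    refine hx (funext fun v => ?_)
    simpa using congrFun h0 (e v)
  · rw [Function.comp_apply, ← h (e.symm i)]
    refine (Fintype.sum_equiv (Equiv.arrowCongr (Equiv.refl _) e.toEquiv) _ _ fun j => ?_).symm
    have himg : (univ : Finset (Fin (k - 1 + 1))).image (Fin.cons i (fun l => e (j l)) :
        Fin (k - 1 + 1) → W) =
        (univ.image (Fin.cons (e.symm i) j : Fin (k - 1 + 1) → V)).map e.toEquiv.toEmbedding := by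
      rw [image_cons_eq, image_cons_eq]
      ext w
      simp only [mem_insert, mem_image, mem_univ, true_and, mem_map_equiv]
      refine or_congr ?_ (exists_congr fun a => ?_)
      · exact e.toEquiv.symm.injective.eq_iff.symm
      · exact e.toEquiv.eq_symm_apply.symm
    have hcl : G.IsNClique k (univ.image (Fin.cons (e.symm i) j : Fin (k - 1 + 1) → V)) ↔
        H.IsNClique k (univ.image (Fin.cons i (fun l => e (j l)) : Fin (k - 1 + 1) → W)) := by
      rw [himg, SimpleGraph.isNClique_iff, SimpleGraph.isNClique_iff, card_map]
      refine and_congr_left fun _ => ?_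
      generalize (univ.image (Fin.cons (e.symm i) j : Fin (k - 1 + 1) → V)) = C
      simp only [SimpleGraph.IsClique, Set.Pairwise, coe_map, Set.forall_mem_image]
      refine forall₂_congr fun a _ => forall₂_congr fun b _ => ?_
      exact imp_congr e.toEquiv.injective.ne_iff.symm e.map_adj_iff.symm
    congr 1
    · simp only [cliqueTensor]
      exact if_congr hcl rfl rfl
    · simp [Equiv.arrowCongr]

theorem cliqueSpectralRadius_eq_of_iso {W : Type*} [Fintype W] {H : SimpleGraph W} (e : G ≃g H)
    (k : ℕ) : cliqueSpectralRadius k G = cliqueSpectralRadius k H := by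
  unfold cliqueSpectralRadius tensorSpectralRadius
  congr 1
  ext t
  exact exists_congr fun z => and_congr_left fun _ =>
    ⟨isTensorEigenvalue_of_iso e, isTensorEigenvalue_of_iso e.symm⟩

end Eigenvalues

section CompleteMultipartite

open scoped Classical

variable {V ι : Type*} {G : SimpleGraph V} {c : V → ι}

theorem cliquePoly_eq_prod_of_adj_iff {R : Type*} [CommSemiring R]
    (hadj : ∀ a b, G.Adj a b ↔ c a ≠ c b) (y : V → R) (J : Finset ι) (S : Finset V)
    (hS : ∀ v ∈ S, c v ∈ J) :
    cliquePoly G S J.card y = ∏ j ∈ J, ∑ v ∈ S.filter (c · = j), y v := by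
  induction J using Finset.induction_on generalizing S with
  | empty => simp [cliquePoly_zero]
  | insert j₀ J hj₀ ih =>
    rw [card_insert_of_notMem hj₀, prod_insert hj₀]
    have h := sum_mul_cliquePoly_neighbors (G := G) S (S.filter (c · = j₀)) (filter_subset _ _)
      J.card y
    have hone : ∀ C ∈ cliquesIn G S (J.card + 1), (S.filter (c · = j₀) ∩ C).card = 1 := by
      intro C hC
      obtain ⟨hCS, hcard, hcl⟩ := mem_cliquesIn.1 hC
      have hinj : Set.InjOn c C := by
        intro a ha b hb hab
        by_contra hne
        exact (hadj a b).1 (hcl ha hb hne) hab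
      have himg : C.image c = insert j₀ J := by
        refine eq_of_subset_of_card_le (image_subset_iff.2 fun v hv => hS v (hCS hv)) ?_
        rw [card_image_of_injOn hinj, hcard, card_insert_of_notMem hj₀]
      obtain ⟨v, hv, hvj⟩ := mem_image.1 (himg ▸ mem_insert_self j₀ J)
      refine card_eq_one.2 ⟨v, ?_⟩
      ext w
      simp only [mem_inter, mem_filter, mem_singleton]
      constructor
      · rintro ⟨⟨-, hw⟩, hwC⟩
        exact hinj hwC hv (hw.trans hvj.symm)
      · rintro rfl
        exact ⟨⟨hCS hv, hvj⟩, hv⟩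
    have hP : cliquePoly G S (J.card + 1) y = ∑ C ∈ cliquesIn G S (J.card + 1),
        ((S.filter (c · = j₀) ∩ C).card : R) * ∏ w ∈ C, y w :=
      sum_congr rfl fun C hC => by rw [hone C hC, Nat.cast_one, one_mul]
    rw [hP, ← h, sum_mul]
    refine sum_congr rfl fun v hv => ?_
    have hvj := (mem_filter.1 hv).2
    rw [ih]
    · congr 1
      refine prod_congr rfl fun j hj => sum_congr ?_ fun _ _ => rfl
      ext w
      simp only [mem_filter, hadj, hvj]
      constructor
      · exact fun h => ⟨h.1.1, h.2⟩
      · rintro ⟨h1, rfl⟩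
        exact ⟨⟨h1, fun h => hj₀ (h ▸ hj)⟩, rfl⟩
    · intro w hw
      rw [mem_filter, hadj, hvj] at hw
      exact (mem_insert.1 (hS w hw.1)).resolve_left (Ne.symm hw.2)

/-- A complete `k`-partite graph has an eigenvalue `z` with `z ^ k` equal to the `(k - 1)`-st power
of the product of the sizes of its parts. -/
theorem exists_pow_eq_prod_card_le_cliqueSpectralRadius [Fintype V] [Fintype ι]
    (hadj : ∀ a b, G.Adj a b ↔ c a ≠ c b) (hc : Function.Surjective c) {k : ℕ} (hk : 1 ≤ k)
    (hι : Fintype.card ι = k) :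
    ∃ L : ℝ, 0 ≤ L ∧ L ^ k = (∏ j, ((univ.filter (c · = j)).card : ℝ)) ^ (k - 1) ∧
      L ≤ cliqueSpectralRadius k G := by
  obtain ⟨m, rfl⟩ : ∃ m, k = m + 1 := ⟨k - 1, by omega⟩
  have hN : ∀ j, (0 : ℝ) < ((univ.filter (c · = j)).card : ℝ) := by
    intro j
    obtain ⟨v, hv⟩ := hc j
    exact_mod_cast card_pos.2 ⟨v, by simp [hv]⟩
  set N : ι → ℝ := fun j => ((univ.filter (c · = j)).card : ℝ) with hNdef
  have hroot : ∀ j, ∃ b : ℝ, 0 < b ∧ N j * b ^ (m + 1) = 1 := by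
    intro j
    refine ⟨(N j)⁻¹ ^ (((m + 1 : ℕ) : ℝ)⁻¹), Real.rpow_pos_of_pos (inv_pos.2 (hN j)) _, ?_⟩
    rw [Real.rpow_inv_natCast_pow (inv_pos.2 (hN j)).le (by omega), mul_inv_cancel₀ (hN j).ne']
  choose b hb hNb using hroot
  have hLpos : 0 < ∏ j, N j * b j := prod_pos fun j _ => mul_pos (hN j) (hb j)
  refine ⟨∏ j, N j * b j, hLpos.le, ?_, ?_⟩
  · rw [← prod_pow, Nat.add_sub_cancel, ← prod_pow]
    refine prod_congr rfl fun j _ => ?_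
    calc (N j * b j) ^ (m + 1) = N j ^ m * (N j * b j ^ (m + 1)) := by ring
      _ = N j ^ m := by rw [hNb, mul_one]
  · have hev : IsTensorEigenvalue (cliqueTensor G (m + 1)) ((∏ j, N j * b j : ℝ) : ℂ) := by
      have hne : Nonempty ι := Fintype.card_pos_iff.1 (by omega)
      obtain ⟨v₀, -⟩ := hc hne.some
      refine ⟨fun v => (b (c v) : ℂ), fun h => ?_, fun i => ?_⟩
      · have := congrFun h v₀
        simp [(hb (c v₀)).ne'] at this
      · rw [tensorApply_cliqueTensor]
        have hcard : (univ.erase (c i)).card = m := by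
          rw [card_erase_of_mem (mem_univ _), card_univ, hι]
          rfl
        have hP := cliquePoly_eq_prod_of_adj_iff hadj (fun v => (b (c v) : ℂ)) (univ.erase (c i))
          (univ.filter (G.Adj i)) (by
            intro v hv
            rw [mem_filter, hadj] at hv
            simp [Ne.symm hv.2])
        rw [hcard] at hP
        rw [hP]
        have hpart : ∀ j ∈ univ.erase (c i),
            ∑ v ∈ (univ.filter (G.Adj i)).filter (c · = j), (b (c v) : ℂ) =
              ((N j * b j : ℝ) : ℂ) := by
          intro j hj
          have hset : (univ.filter (G.Adj i)).filter (c · = j) = univ.filter (c · = j) := by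
            ext v
            simp only [mem_filter, mem_univ, true_and, hadj, and_iff_right_iff_imp]
            rintro rfl
            exact (ne_of_mem_erase hj).symm
          rw [hset, sum_congr rfl fun v hv => by rw [(mem_filter.1 hv).2], sum_const, nsmul_eq_mul]
          simp [hNdef]
        rw [prod_congr rfl hpart, ← Complex.ofReal_prod, ← Complex.ofReal_pow,
          ← Complex.ofReal_mul]
        congr 1
        rw [← mul_prod_erase univ _ (mem_univ (c i))]
        have := hNb (c i)
        show _ = N (c i) * b (c i) * _ * b (c i) ^ m
        calc _ = (N (c i) * b (c i) ^ (m + 1)) * ∏ j ∈ univ.erase (c i), N j * b j := by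
              rw [this, one_mul]
          _ = _ := by ring
    have := le_cliqueSpectralRadius hev
    rwa [Complex.norm_real, Real.norm_of_nonneg hLpos.le] at this

theorem nonempty_iso_of_card_fiber_eq [Fintype V] {W : Type*} [Fintype W] {H : SimpleGraph W}
    {d : W → ι} (hadj : ∀ a b, G.Adj a b ↔ c a ≠ c b) (hadj' : ∀ a b, H.Adj a b ↔ d a ≠ d b)
    (hcard : ∀ j, (univ.filter (c · = j)).card = (univ.filter (d · = j)).card) :
    Nonempty (G ≃g H) := by
  have he : ∀ j, Nonempty ({v // c v = j} ≃ {w // d w = j}) := by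
    intro j
    rw [← Fintype.card_eq, Fintype.card_subtype, Fintype.card_subtype]
    exact hcard j
  let e : V ≃ W := Equiv.ofFiberEquiv fun j => (he j).some
  have hde : ∀ v, d (e v) = c v := fun v => Equiv.ofFiberEquiv_map _ v
  exact ⟨⟨e, by intro a b; rw [hadj', hadj, hde, hde]⟩⟩

theorem one_le_cliqueSpectralRadius_of_unique [Fintype V] {k : ℕ} (hk : 1 ≤ k) {K : Finset V}
    (hK : cliquesIn G univ k = {K}) : 1 ≤ cliqueSpectralRadius k G := by
  obtain ⟨m, rfl⟩ : ∃ m, k = m + 1 := ⟨k - 1, by omega⟩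
  have hKm : K ∈ cliquesIn G univ (m + 1) := by simp [hK]
  have huniq : ∀ D ∈ cliquesIn G univ (m + 1), D = K := by
    intro D hD
    simpa [hK] using hD
  obtain ⟨-, hcard, hcl⟩ := mem_cliquesIn.1 hKm
  have hev : IsTensorEigenvalue (cliqueTensor G (m + 1)) 1 := by
    refine ⟨fun v => if v ∈ K then 1 else 0, fun h => ?_, fun i => ?_⟩
    · obtain ⟨v, hv⟩ := card_pos.1 (by omega : 0 < K.card)
      have := congrFun h v
      simp [hv] at this
    · rw [tensorApply_cliqueTensor, cliquePoly, one_mul]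
      have hins : ∀ D ∈ cliquesIn G (univ.filter (G.Adj i)) m, i ∉ D ∧ insert i D = K := by
        intro D hD
        have hD' := mem_cliquesIn.1 hD
        have hi : i ∉ D := fun h => by simpa using hD'.1 h
        refine ⟨hi, huniq _ (mem_cliquesIn.2 ⟨subset_univ _, ?_, ?_⟩)⟩
        · rw [card_insert_of_notMem hi, hD'.2.1]
        · rw [coe_insert]
          exact hD'.2.2.insert fun b hb _ => (mem_filter.1 (hD'.1 hb)).2
      by_cases hi : i ∈ K
      · have hset : cliquesIn G (univ.filter (G.Adj i)) m = {K.erase i} := by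
          ext D
          rw [mem_singleton]
          constructor
          · intro hD
            obtain ⟨h1, h2⟩ := hins D hD
            rw [← h2, erase_insert h1]
          · rintro rfl
            refine mem_cliquesIn.2 ⟨fun v hv => ?_, ?_, hcl.subset (by simp)⟩
            · rw [mem_erase] at hv
              exact mem_filter.2 ⟨mem_univ _, hcl hi hv.2 (Ne.symm hv.1)⟩
            · rw [card_erase_of_mem hi, hcard]
              rfl
        rw [hset, sum_singleton, prod_congr rfl fun v hv => if_pos (mem_of_mem_erase hv)]
        simp [hi]
      · have hset : cliquesIn G (univ.filter (G.Adj i)) m = ∅ := by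
          refine eq_empty_of_forall_notMem fun D hD => hi ?_
          rw [← (hins D hD).2]
          exact mem_insert_self i D
        have hm : m ≠ 0 := by
          rintro rfl
          rw [cliquesIn_zero] at hset
          simp at hset
        simp [hset, hi, hm]
  simpa using le_cliqueSpectralRadius hev

end CompleteMultipartite

theorem pow_card_mul_prod_le_sum_pow {ι : Type*} (s : Finset ι) (a : ι → ℝ)
    (ha : ∀ i ∈ s, 0 ≤ a i) :
    (s.card : ℝ) ^ s.card * ∏ i ∈ s, a i ≤ (∑ i ∈ s, a i) ^ s.card := by
  rcases s.eq_empty_or_nonempty with rfl | hs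
  · simp
  have hpos : (0 : ℝ) < s.card := by exact_mod_cast card_pos.2 hs
  have h := Real.geom_mean_le_arith_mean s (fun _ => 1) a (fun _ _ => zero_le_one)
    (by simpa using hs) ha
  simp only [Real.rpow_one, sum_const, nsmul_eq_mul, mul_one, one_mul] at h
  have hprod : 0 ≤ ∏ i ∈ s, a i := prod_nonneg ha
  have h2 := pow_le_pow_left₀ (Real.rpow_nonneg hprod _) h s.card
  rw [Real.rpow_inv_natCast_pow hprod (card_pos.2 hs).ne', div_pow,
    le_div_iff₀ (pow_pos hpos _)] at h2
  linarith

theorem sum_pow_le_card_pow_mul_sum_pow {ι : Type*} (s : Finset ι) (f : ι → ℝ)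
    (hf : ∀ i ∈ s, 0 ≤ f i) {k : ℕ} (hk : 1 ≤ k) :
    (∑ i ∈ s, f i) ^ k ≤ (s.card : ℝ) ^ (k - 1) * ∑ i ∈ s, f i ^ k := by
  obtain ⟨m, rfl⟩ : ∃ m, k = m + 1 := ⟨k - 1, by omega⟩
  rcases s.eq_empty_or_nonempty with rfl | hs
  · simp
  have hpos : (0 : ℝ) < s.card := by exact_mod_cast card_pos.2 hs
  have h := pow_sum_div_card_le_sum_pow hf m
  rw [div_le_iff₀ (pow_pos hpos m)] at h
  rw [Nat.add_sub_cancel]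
  linarith

section UpperBounds

open scoped Classical

variable {V : Type*} {G : SimpleGraph V}

theorem cliquePoly_le_sum_pow {w : V → ℝ} (hw : ∀ v, 0 ≤ w v) (k : ℕ) (S : Finset V) :
    cliquePoly G S k w ≤ (∑ v ∈ S, w v) ^ k := by
  induction k generalizing S with
  | zero => simp [cliquePoly_zero]
  | succ k ih =>
    have hX : 0 ≤ ∑ v ∈ S, w v := sum_nonneg fun v _ => hw v
    calc cliquePoly G S (k + 1) w
        ≤ ∑ C ∈ cliquesIn G S (k + 1), ((S ∩ C).card : ℝ) * ∏ v ∈ C, w v := by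
          refine sum_le_sum fun C hC => ?_
          obtain ⟨h1, h2, -⟩ := mem_cliquesIn.1 hC
          rw [inter_eq_right.2 h1, h2]
          exact le_mul_of_one_le_left (prod_nonneg fun v _ => hw v) (by norm_cast; omega)
      _ = ∑ v ∈ S, w v * cliquePoly G (S.filter (G.Adj v)) k w :=
          (sum_mul_cliquePoly_neighbors S S subset_rfl k w).symm
      _ ≤ ∑ v ∈ S, w v * (∑ v ∈ S, w v) ^ k := by
          refine sum_le_sum fun v _ => mul_le_mul_of_nonneg_left ?_ (hw v)
          refine (ih _).trans (pow_le_pow_left₀ (sum_nonneg fun v _ => hw v) ?_ k)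
          exact sum_le_sum_of_subset_of_nonneg (filter_subset _ _) fun v _ _ => hw v
      _ = (∑ v ∈ S, w v) ^ (k + 1) := by rw [← sum_mul, pow_succ']

/-- The power mean inequality for the clique polynomial. -/
theorem cliquePoly_pow_le_card [Fintype V] {y : V → ℝ} (hy : ∀ v, 0 ≤ y v) {k : ℕ} (hk : 1 ≤ k) :
    cliquePoly G univ k y ^ k ≤
      ((cliquesIn G univ k).card : ℝ) ^ (k - 1) * (∑ v, y v ^ k) ^ k := by
  refine (sum_pow_le_card_pow_mul_sum_pow _ _ (fun C _ => prod_nonneg fun v _ => hy v) hk).trans ?_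
  refine mul_le_mul_of_nonneg_left ?_ (by positivity)
  simp_rw [← prod_pow]
  exact cliquePoly_le_sum_pow (G := G) (fun v => pow_nonneg (hy v) k) k univ

/-- If all `k`-cliques contain a fixed set of `t` vertices, then the clique polynomial is bounded
by the part sizes of some complete multipartite graph, with a description of equality. -/
theorem cliquePoly_pow_le_of_forall_subset [Fintype V] {y : V → ℝ} (hy : ∀ v, 0 ≤ y v)
    {k s t : ℕ} (hk : k = t + s) (ht : 1 ≤ t) {T : Finset V} (hTcard : T.card = t)
    (hT : ∀ C ∈ cliquesIn G univ k, T ⊆ C) :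
    ∃ (S : Finset V) (c : V → ℕ), Disjoint S T ∧ (∀ v ∈ S, c v < s) ∧
      (k * cliquePoly G univ k y) ^ k ≤
        (∏ j ∈ range s, ((S.filter (c · = j)).card : ℝ)) ^ (k - 1) * (∑ v, y v ^ k) ^ k ∧
      (0 < cliquePoly G univ k y →
        (k * cliquePoly G univ k y) ^ k =
          (∏ j ∈ range s, ((S.filter (c · = j)).card : ℝ)) ^ (k - 1) * (∑ v, y v ^ k) ^ k →
        G.IsClique T ∧ (∀ v ∈ S, ∀ w ∈ T, G.Adj v w) ∧
          ∀ a ∈ S, ∀ b ∈ S, G.Adj a b ↔ c a ≠ c b) := by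
  have hk0 : k ≠ 0 := by omega
  rcases (cliquesIn G univ k).eq_empty_or_nonempty with hF | ⟨C₀, hC₀⟩
  · have hP : cliquePoly G univ k y = 0 := by simp [cliquePoly, hF]
    refine ⟨∅, fun _ => 0, by simp, by simp, ?_, fun h => absurd h (by simp [hP])⟩
    rw [hP, mul_zero, zero_pow hk0]
    have : 0 ≤ ∑ v, y v ^ k := sum_nonneg fun v _ => pow_nonneg (hy v) k
    positivity
  have hTcl : G.IsClique T := (mem_cliquesIn.1 hC₀).2.2.subset (coe_subset.2 (hT C₀ hC₀))
  set S := univ.filter fun v => v ∉ T ∧ (∀ w ∈ T, G.Adj v w) ∧ 0 < y v with hS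
  have hdisj : Disjoint S T := by
    rw [disjoint_left]
    exact fun v hv => (mem_filter.1 hv).2.1
  have hSpos : ∀ v ∈ S, 0 < y v := fun v hv => (mem_filter.1 hv).2.2.2
  have hSadj : ∀ v ∈ S, ∀ w ∈ T, G.Adj v w := fun v hv => (mem_filter.1 hv).2.2.1
  have hfree : cliquesIn G S (s + 1) = ∅ := by
    refine eq_empty_of_forall_notMem fun D hD => ?_
    obtain ⟨hDS, hDcard, hDcl⟩ := mem_cliquesIn.1 hD
    obtain ⟨w, hw⟩ := card_pos.1 (by omega : 0 < T.card)
    have hDT : Disjoint T D := (disjoint_of_subset_left hDS hdisj).symm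
    have hmem : (T ∪ D).erase w ∈ cliquesIn G univ k := by
      refine mem_cliquesIn.2 ⟨subset_univ _, ?_, ?_⟩
      · rw [card_erase_of_mem (mem_union_left _ hw), card_union_of_disjoint hDT, hDcard, hTcard, hk]
        omega
      · refine SimpleGraph.IsClique.subset (s := (↑T ∪ ↑D : Set V)) ?_ ?_
        · intro v hv
          have := mem_of_mem_erase (mem_coe.1 hv)
          simpa using this
        · rintro a (ha | ha) b (hb | hb) hab
          · exact hTcl ha hb hab
          · exact (hSadj b (hDS hb) a ha).symm
          · exact hSadj a (hDS ha) b hb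
          · exact hDcl ha hb hab
    exact notMem_erase w _ (hT _ hmem hw)
  obtain ⟨c, hcs, hcle, hceq⟩ := exists_coloring_cliquePoly_le hy s S hfree
  have hτ : 0 ≤ ∏ v ∈ T, y v := prod_nonneg fun v _ => hy v
  have hPQ : cliquePoly G univ k y ≤ (∏ v ∈ T, y v) * cliquePoly G S s y := by
    have hF : cliquePoly G univ k y =
        ∑ C ∈ (cliquesIn G univ k).filter (fun C => ∀ v ∈ C, 0 < y v), ∏ v ∈ C, y v := by
      refine (sum_filter_of_ne fun C _ hne v hv => ?_).symm
      exact lt_of_le_of_ne (hy v) (Ne.symm (prod_ne_zero_iff.1 hne v hv))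
    rw [hF, cliquePoly, mul_sum]
    have hF2 : ∀ C ∈ (cliquesIn G univ k).filter (fun C => ∀ v ∈ C, 0 < y v),
        ∏ v ∈ C, y v = (∏ v ∈ T, y v) * ∏ v ∈ C \ T, y v := by
      intro C hC
      rw [mul_comm, prod_sdiff (hT C (mem_filter.1 hC).1)]
    rw [sum_congr rfl hF2, ← sum_image (f := fun D => (∏ v ∈ T, y v) * ∏ v ∈ D, y v)
      (g := fun C => C \ T)]
    · refine sum_le_sum_of_subset_of_nonneg ?_ fun D _ _ =>
        mul_nonneg hτ (prod_nonneg fun v _ => hy v)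
      intro D hD
      obtain ⟨C, hC, rfl⟩ := mem_image.1 hD
      obtain ⟨hC, hpos⟩ := mem_filter.1 hC
      obtain ⟨-, hcard, hcl⟩ := mem_cliquesIn.1 hC
      refine mem_cliquesIn.2 ⟨fun v hv => ?_, ?_, hcl.subset (by simp)⟩
      · rw [mem_sdiff] at hv
        refine mem_filter.2 ⟨mem_univ _, hv.2, fun w hw => ?_, hpos v hv.1⟩
        refine hcl hv.1 (hT C hC hw) ?_
        rintro rfl
        exact hv.2 hw
      · rw [card_sdiff_of_subset (hT C hC), hcard, hTcard, hk]
        omega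
    · intro C hC C' hC' h
      have h1 := hT C (mem_filter.1 hC).1
      have h2 := hT C' (mem_filter.1 hC').1
      rw [← sdiff_union_of_subset h1, ← sdiff_union_of_subset h2]
      exact congrArg (· ∪ T) h
  set X : ℕ → ℝ := fun j => ∑ v ∈ S.filter (c · = j), y v with hX
  set N : ℕ → ℝ := fun j => ((S.filter (c · = j)).card : ℝ) with hN
  set Y : ℕ → ℝ := fun j => ∑ v ∈ S.filter (c · = j), y v ^ k with hY
  have hQR : (∏ v ∈ T, y v) * cliquePoly G S s y ≤ (∏ v ∈ T, y v) * ∏ j ∈ range s, X j :=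
    mul_le_mul_of_nonneg_left hcle hτ
  have hXnn : ∀ j, 0 ≤ X j := fun j => sum_nonneg fun v _ => hy v
  have hYnn : ∀ j, 0 ≤ Y j := fun j => sum_nonneg fun v _ => pow_nonneg (hy v) k
  have hNnn : ∀ j, 0 ≤ N j := fun j => Nat.cast_nonneg _
  have hXY : ∀ j, X j ^ k ≤ N j ^ (k - 1) * Y j := by
    intro j
    exact sum_pow_le_card_pow_mul_sum_pow _ _ (fun v _ => hy v) (by omega)
  have hmean : (k : ℝ) ^ k * ((∏ v ∈ T, y v ^ k) * ∏ j ∈ range s, Y j) ≤ (∑ v, y v ^ k) ^ k := by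
    have h := pow_card_mul_prod_le_sum_pow (T.disjSum (range s))
      (Sum.elim (fun v => y v ^ k) Y) (by
        rintro (v | j) -
        · exact pow_nonneg (hy v) k
        · exact hYnn j)
    rw [card_disjSum, hTcard, card_range, ← hk, prod_disjSum, sum_disjSum] at h
    simp only [Sum.elim_inl, Sum.elim_inr] at h
    refine h.trans (pow_le_pow_left₀ (add_nonneg (sum_nonneg fun v _ => pow_nonneg (hy v) k)
      (sum_nonneg fun j _ => hYnn j)) ?_ k)
    rw [sum_fiberwise_of_maps_to (fun v hv => mem_range.2 (hcs v hv)) (fun v => y v ^ k), add_comm,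
      ← sum_union hdisj]
    exact sum_le_sum_of_subset_of_nonneg (subset_univ _) fun v _ _ => pow_nonneg (hy v) k
  have hRk : (k * ((∏ v ∈ T, y v) * ∏ j ∈ range s, X j)) ^ k ≤
      (∏ j ∈ range s, N j) ^ (k - 1) * (∑ v, y v ^ k) ^ k := by
    calc (k * ((∏ v ∈ T, y v) * ∏ j ∈ range s, X j)) ^ k
        = (k : ℝ) ^ k * ((∏ v ∈ T, y v ^ k) * ∏ j ∈ range s, X j ^ k) := by
          rw [mul_pow, mul_pow, prod_pow, prod_pow]
      _ ≤ (k : ℝ) ^ k * ((∏ v ∈ T, y v ^ k) * ∏ j ∈ range s, (N j ^ (k - 1) * Y j)) := by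
          refine mul_le_mul_of_nonneg_left (mul_le_mul_of_nonneg_left
            (prod_le_prod (fun j _ => pow_nonneg (hXnn j) k) fun j _ => hXY j)
            (prod_nonneg fun v _ => pow_nonneg (hy v) k)) (by positivity)
      _ = (∏ j ∈ range s, N j) ^ (k - 1) *
          ((k : ℝ) ^ k * ((∏ v ∈ T, y v ^ k) * ∏ j ∈ range s, Y j)) := by
          rw [prod_mul_distrib, prod_pow (range s) (k - 1) N]
          ring
      _ ≤ _ := mul_le_mul_of_nonneg_left hmean (pow_nonneg (prod_nonneg fun j _ => hNnn j) _)
  have hPnn : 0 ≤ cliquePoly G univ k y := cliquePoly_nonneg hy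
  have hPR := hPQ.trans hQR
  have hkpos : (0 : ℝ) < k := by exact_mod_cast Nat.pos_of_ne_zero hk0
  refine ⟨S, c, hdisj, hcs, (pow_le_pow_left₀ (by positivity)
    (mul_le_mul_of_nonneg_left hPR hkpos.le) k).trans hRk, fun hP heq => ?_⟩
  have hRP : k * ((∏ v ∈ T, y v) * ∏ j ∈ range s, X j) ≤ k * cliquePoly G univ k y := by
    refine le_of_pow_le_pow_left₀ hk0 (by positivity) ?_
    rw [heq]
    exact hRk
  have hRP' := le_of_mul_le_mul_left hRP hkpos
  have hQpos : 0 < (∏ v ∈ T, y v) * cliquePoly G S s y := lt_of_lt_of_le hP hPQ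
  have hτpos : 0 < ∏ v ∈ T, y v := pos_of_mul_pos_left hQpos (cliquePoly_nonneg hy)
  have hPspos : 0 < cliquePoly G S s y := pos_of_mul_pos_right hQpos hτ
  refine ⟨hTcl, hSadj, hceq hSpos hPspos (mul_left_cancel₀ hτpos.ne' ?_)⟩
  linarith

theorem card_filter_subset_le [Fintype V] {k : ℕ} (F : Finset (Finset V))
    (hF : ∀ C ∈ F, C.card = k) (U : Finset V) :
    (F.filter (U ⊆ ·)).card ≤ (Fintype.card V - U.card).choose (k - U.card) := by
  rw [← card_compl, ← card_powersetCard]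
  refine card_le_card_of_injOn (fun C => C \ U) ?_ ?_
  · intro C hC
    obtain ⟨hC, hU⟩ := mem_filter.1 (mem_coe.1 hC)
    rw [mem_coe, mem_powersetCard, card_sdiff_of_subset hU, hF C hC]
    exact ⟨fun v hv => mem_compl.2 (mem_sdiff.1 hv).2, rfl⟩
  · intro C hC C' hC' h
    have h1 := (mem_filter.1 (mem_coe.1 hC)).2
    have h2 := (mem_filter.1 (mem_coe.1 hC')).2
    rw [← sdiff_union_of_subset h1, ← sdiff_union_of_subset h2]
    exact congrArg (· ∪ U) h

/-- The size of a `t`-intersecting family of `k`-sets whose members have no common `t`-set. -/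
theorem card_le_of_intersecting [Fintype V] {k t : ℕ} (F : Finset (Finset V))
    (hF : ∀ C ∈ F, C.card = k) (hint : ∀ A ∈ F, ∀ B ∈ F, t ≤ (A ∩ B).card)
    (hnon : ∀ T : Finset V, T.card = t → ∃ C ∈ F, ¬ T ⊆ C) :
    F.card ≤ k.choose t * (k * (Fintype.card V - (t + 1)).choose (k - (t + 1))) := by
  rcases F.eq_empty_or_nonempty with rfl | ⟨A, hA⟩
  · simp
  have hD : ∀ T : Finset V, ∃ C, T.card = t → C ∈ F ∧ ¬ T ⊆ C := by
    intro T
    by_cases h : T.card = t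
    · obtain ⟨C, hC⟩ := hnon T h
      exact ⟨C, fun _ => hC⟩
    · exact ⟨∅, fun h' => absurd h' h⟩
  choose D hD using hD
  have hcover : F ⊆ (A.powersetCard t).biUnion fun T => (D T \ T).biUnion fun d =>
      F.filter (insert d T ⊆ ·) := by
    intro B hB
    obtain ⟨T, hTsub, hTcard⟩ := exists_subset_card_eq (hint A hA B hB)
    obtain ⟨hDF, hDT⟩ := hD T hTcard
    have hex : ∃ d ∈ D T ∩ B, d ∉ T := by
      by_contra hcon
      push Not at hcon
      have : D T ∩ B = T := eq_of_subset_of_card_le hcon (by rw [hTcard]; exact hint _ hDF _ hB)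
      exact hDT (this.symm.subset.trans inter_subset_left)
    obtain ⟨d, hd, hdT⟩ := hex
    rw [mem_inter] at hd
    simp only [mem_biUnion, mem_powersetCard, mem_sdiff, mem_filter]
    exact ⟨T, ⟨hTsub.trans inter_subset_left, hTcard⟩, d, ⟨hd.1, hdT⟩, hB,
      insert_subset hd.2 (hTsub.trans inter_subset_right)⟩
  refine (card_le_card hcover).trans ?_
  rw [← hF A hA, ← card_powersetCard, hF A hA]
  refine card_biUnion_le_card_mul _ _ _ fun T hT => ?_
  have hTcard := (mem_powersetCard.1 hT).2
  have hDcard : (D T \ T).card ≤ k := (card_le_card sdiff_subset).trans (hF _ (hD T hTcard).1).le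
  refine (card_biUnion_le_card_mul _ _ ((Fintype.card V - (t + 1)).choose (k - (t + 1)))
    fun d hd => ?_).trans (Nat.mul_le_mul_right _ hDcard)
  have := card_filter_subset_le F hF (insert d T)
  rwa [card_insert_of_notMem (mem_sdiff.1 hd).2, hTcard] at this

end UpperBounds

section Balanced

theorem mul_pow_le_add {q : ℕ} (hq : 1 ≤ q) (a d : ℕ) (h : a + d ≤ q) :
    (a : ℝ) * (1 + 1 / q) ^ d ≤ a + d ∧ (0 < d → (a : ℝ) * (1 + 1 / q) ^ d < a + d) := by
  have hq0 : (0 : ℝ) < q := by exact_mod_cast hq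
  induction d with
  | zero => simp
  | succ d ih =>
    have h1 := (ih (by omega)).1
    have hlt : (a : ℝ) * (1 + 1 / q) ^ (d + 1) < a + (d + 1 : ℕ) := by
      have h2 : ((a : ℝ) + d) * (1 / q) < 1 := by
        rw [mul_one_div, div_lt_one hq0]
        exact_mod_cast h
      calc (a : ℝ) * (1 + 1 / q) ^ (d + 1) = (a * (1 + 1 / q) ^ d) * (1 + 1 / q) := by ring
        _ ≤ (a + d) * (1 + 1 / q) := mul_le_mul_of_nonneg_right h1 (by positivity)
        _ = a + d + (a + d) * (1 / q) := by ring
        _ < a + (d + 1 : ℕ) := by push_cast; linarith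
    exact ⟨hlt.le, fun _ => hlt⟩

theorem add_le_mul_pow {q : ℕ} (hq : 1 ≤ q) (d : ℕ) :
    ((q + 1 + d : ℕ) : ℝ) ≤ (q + 1 : ℕ) * (1 + 1 / q) ^ d ∧
      (0 < d → ((q + 1 + d : ℕ) : ℝ) < (q + 1 : ℕ) * (1 + 1 / q) ^ d) := by
  have hq0 : (0 : ℝ) < q := by exact_mod_cast hq
  induction d with
  | zero => simp
  | succ d ih =>
    have h1 := ih.1
    have hlt : ((q + 1 + (d + 1) : ℕ) : ℝ) < (q + 1 : ℕ) * (1 + 1 / q) ^ (d + 1) := by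
      have h2 : 1 < ((q + 1 + d : ℕ) : ℝ) * (1 / q) := by
        rw [mul_one_div, one_lt_div hq0]
        exact_mod_cast (by omega : q < q + 1 + d)
      calc ((q + 1 + (d + 1) : ℕ) : ℝ) = ((q + 1 + d : ℕ) : ℝ) + 1 := by push_cast; ring
        _ < ((q + 1 + d : ℕ) : ℝ) + ((q + 1 + d : ℕ) : ℝ) * (1 / q) := by linarith
        _ = ((q + 1 + d : ℕ) : ℝ) * (1 + 1 / q) := by ring
        _ ≤ ((q + 1 : ℕ) * (1 + 1 / q) ^ d) * (1 + 1 / q) :=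
          mul_le_mul_of_nonneg_right h1 (by positivity)
        _ = _ := by ring
    exact ⟨hlt.le, fun _ => hlt⟩

/-- The exponential function through `(q, q)` and `(q + 1, q + 1)` lies above the identity at all
other integers. -/
theorem mul_pow_lt_mul_pow {q : ℕ} (hq : 1 ≤ q) {a : ℕ} (h1 : a ≠ q) (h2 : a ≠ q + 1) :
    (a : ℝ) * (1 + 1 / q) ^ q < q * (1 + 1 / q) ^ a := by
  have hq0 : (0 : ℝ) < q := by exact_mod_cast hq
  have hβ : (0 : ℝ) < 1 + 1 / q := by positivity
  rcases lt_or_gt_of_ne h1 with h | h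
  · obtain ⟨d, rfl⟩ := Nat.exists_eq_add_of_lt h
    have := (mul_pow_le_add hq a (d + 1) (by omega)).2 (by omega)
    calc (a : ℝ) * (1 + 1 / (a + d + 1 : ℕ)) ^ (a + d + 1)
        = (a * (1 + 1 / (a + d + 1 : ℕ)) ^ (d + 1)) * (1 + 1 / (a + d + 1 : ℕ)) ^ a := by ring
      _ < (a + (d + 1 : ℕ)) * (1 + 1 / (a + d + 1 : ℕ)) ^ a :=
        mul_lt_mul_of_pos_right this (pow_pos hβ _)
      _ = _ := by push_cast; ring
  · obtain ⟨d, rfl⟩ := Nat.exists_eq_add_of_lt h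
    obtain ⟨e, rfl⟩ : ∃ e, d = e + 1 := ⟨d - 1, by omega⟩
    have := (add_le_mul_pow hq (e + 1)).2 (by omega)
    have hqβ : (q : ℝ) * (1 + 1 / q) = (q + 1 : ℕ) := by
      push_cast
      field_simp
    calc ((q + (e + 1) + 1 : ℕ) : ℝ) * (1 + 1 / q) ^ q
        = ((q + 1 + (e + 1) : ℕ) : ℝ) * (1 + 1 / q) ^ q := by
          congr 2
          omega
      _ < ((q + 1 : ℕ) * (1 + 1 / q) ^ (e + 1)) * (1 + 1 / q) ^ q :=
        mul_lt_mul_of_pos_right this (pow_pos hβ _)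
      _ = _ := by
        rw [← hqβ]
        ring

theorem mul_pow_eq_mul_pow {q : ℕ} (hq : 1 ≤ q) {a : ℕ} (h : a = q ∨ a = q + 1) :
    (a : ℝ) * (1 + 1 / q) ^ q = q * (1 + 1 / q) ^ a := by
  have hq0 : (0 : ℝ) < q := by exact_mod_cast hq
  rcases h with rfl | rfl
  · rfl
  · have hqβ : (q : ℝ) * (1 + 1 / q) = (q + 1 : ℕ) := by
      push_cast
      field_simp
    rw [← hqβ]
    ring

variable {ι : Type*} [Fintype ι]

/-- A product of natural numbers with a bounded sum is largest for a balanced distribution, and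
only then. -/
theorem prod_le_prod_of_balanced {q : ℕ} (hq : 1 ≤ q) {f g : ι → ℕ}
    (hg : ∀ i, g i = q ∨ g i = q + 1) (hsum : ∑ i, f i ≤ ∑ i, g i) :
    ∏ i, f i ≤ ∏ i, g i ∧
      (∏ i, f i = ∏ i, g i → (∀ i, f i = q ∨ f i = q + 1) ∧ ∑ i, f i = ∑ i, g i) := by
  have hq0 : (0 : ℝ) < q := by exact_mod_cast hq
  set β : ℝ := 1 + 1 / q with hβdef
  have hβ : 1 < β := by
    have : (0 : ℝ) < 1 / q := by positivity
    linarith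
  have hβ0 : 0 < β := by linarith
  have hle : ∀ i, (f i : ℝ) * β ^ q ≤ q * β ^ f i := by
    intro i
    by_cases h : f i = q ∨ f i = q + 1
    · exact (mul_pow_eq_mul_pow hq h).le
    · rw [not_or] at h
      exact (mul_pow_lt_mul_pow hq h.1 h.2).le
  have hprodg : ((∏ i, g i : ℕ) : ℝ) * ∏ _i : ι, β ^ q = (∏ _i : ι, (q : ℝ)) * β ^ ∑ i, g i := by
    rw [Nat.cast_prod, ← prod_mul_distrib, ← prod_pow_eq_pow_sum, ← prod_mul_distrib]
    exact prod_congr rfl fun i _ => mul_pow_eq_mul_pow hq (hg i)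
  have hprodf : ((∏ i, f i : ℕ) : ℝ) * ∏ _i : ι, β ^ q = ∏ i, ((f i : ℝ) * β ^ q) := by
    rw [Nat.cast_prod, ← prod_mul_distrib]
  have hprodf' : ∏ i, ((q : ℝ) * β ^ f i) = (∏ _i : ι, (q : ℝ)) * β ^ ∑ i, f i := by
    rw [← prod_pow_eq_pow_sum, ← prod_mul_distrib]
  have h1 : ∏ i, ((f i : ℝ) * β ^ q) ≤ ∏ i, ((q : ℝ) * β ^ f i) :=
    prod_le_prod (fun i _ => by positivity) fun i _ => hle i
  have hQ : 0 < ∏ _i : ι, (q : ℝ) := prod_pos fun _ _ => hq0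
  have hB : 0 < ∏ _i : ι, β ^ q := prod_pos fun _ _ => pow_pos hβ0 q
  have h2 : (∏ _i : ι, (q : ℝ)) * β ^ ∑ i, f i ≤ (∏ _i : ι, (q : ℝ)) * β ^ ∑ i, g i :=
    mul_le_mul_of_nonneg_left (pow_le_pow_right₀ hβ.le hsum) hQ.le
  constructor
  · have : ((∏ i, f i : ℕ) : ℝ) ≤ ((∏ i, g i : ℕ) : ℝ) := by
      refine le_of_mul_le_mul_right ?_ hB
      rw [hprodf, hprodg]
      exact h1.trans (hprodf'.le.trans h2)
    exact_mod_cast this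
  · intro heq
    have hfpos : ∀ i, 0 < f i := by
      intro i
      have hgpos : 0 < ∏ i, g i := prod_pos fun i _ => by
        rcases hg i with h | h <;> omega
      rw [← heq] at hgpos
      exact Nat.pos_of_ne_zero (prod_ne_zero_iff.1 hgpos.ne' i (mem_univ i))
    rw [← heq, hprodf] at hprodg
    constructor
    · by_contra hcon
      push Not at hcon
      obtain ⟨i, hi⟩ := hcon
      have := prod_lt_prod (s := univ) (f := fun i => (f i : ℝ) * β ^ q)
        (g := fun i => (q : ℝ) * β ^ f i)
        (fun i _ => mul_pos (by exact_mod_cast hfpos i) (pow_pos hβ0 q)) (fun i _ => hle i)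
        ⟨i, mem_univ i, mul_pow_lt_mul_pow hq hi.1 hi.2⟩
      linarith
    · refine le_antisymm hsum ?_
      by_contra hlt
      have := mul_lt_mul_of_pos_left (pow_lt_pow_right₀ hβ (not_le.1 hlt)) hQ
      linarith

theorem exists_perm_of_balanced {q : ℕ} {f g : ι → ℕ} (hf : ∀ i, f i = q ∨ f i = q + 1)
    (hg : ∀ i, g i = q ∨ g i = q + 1) (hsum : ∑ i, f i = ∑ i, g i) :
    ∃ σ : Equiv.Perm ι, ∀ i, g (σ i) = f i := by
  have key : ∀ h : ι → ℕ, (∀ i, h i = q ∨ h i = q + 1) →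
      ∑ i, h i = Fintype.card ι * q + (univ.filter fun i => h i = q + 1).card := by
    intro h hh
    rw [card_filter, ← card_univ, ← smul_eq_mul, ← sum_const, ← sum_add_distrib]
    refine sum_congr rfl fun i _ => ?_
    rcases hh i with h | h <;> simp [h]
  have key2 : ∀ h : ι → ℕ, (∀ i, h i = q ∨ h i = q + 1) →
      (univ.filter fun i => h i = q).card + (univ.filter fun i => h i = q + 1).card =
        Fintype.card ι := by
    intro h hh
    rw [← card_univ, ← card_filter_add_card_filter_not (s := univ) (fun i => h i = q)]
    congr 2
    ext i
    rcases hh i with h | h <;> simp [h]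
  have hf1 := key f hf
  have hg1 := key g hg
  have hf2 := key2 f hf
  have hg2 := key2 g hg
  have hcard : ∀ a, Nonempty ({i // f i = a} ≃ {i // g i = a}) := by
    intro a
    rw [← Fintype.card_eq, Fintype.card_subtype, Fintype.card_subtype]
    by_cases ha : a = q
    · subst ha
      omega
    by_cases ha' : a = q + 1
    · subst ha'
      omega
    rw [card_eq_zero.2, card_eq_zero.2]
    · refine filter_eq_empty_iff.2 fun i _ h => ?_
      rcases hg i with h' | h' <;> omega
    · refine filter_eq_empty_iff.2 fun i _ h => ?_
      rcases hf i with h' | h' <;> omega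
  exact ⟨Equiv.ofFiberEquiv fun a => (hcard a).some, fun i => Equiv.ofFiberEquiv_map _ i⟩

theorem turan_part_eq {s m i : ℕ} (hi : i < s) :
    (m + i) / s = m / s ∨ (m + i) / s = m / s + 1 := by
  have h1 : m / s ≤ (m + i) / s := Nat.div_le_div_right (Nat.le_add_right m i)
  have h2 : (m + i) / s ≤ (m + s) / s := Nat.div_le_div_right (by omega)
  rw [Nat.add_div_right m (by omega)] at h2
  omega

end Balanced

section TwoCliques

open scoped Classical

theorem card_union_lt_of_twoCliques_free {V : Type*} {G : SimpleGraph V} {r : ℕ}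
    (hfree : (twoCliques r).Free G) {A B : Finset V} (hA : G.IsClique A) (hB : G.IsClique B)
    (hAr : r ≤ A.card) (hBr : r ≤ B.card) : (A ∪ B).card < 2 * r := by
  by_contra hcon
  rw [not_lt] at hcon
  obtain ⟨A', B', hA'A, hB'B, hA', hB', hdisj⟩ : ∃ A' B' : Finset V, A' ⊆ A ∧ B' ⊆ B ∧
      A'.card = r ∧ B'.card = r ∧ Disjoint A' B' := by
    by_cases hr : r ≤ (A \ B).card
    · obtain ⟨A', hA'1, hA'2⟩ := exists_subset_card_eq hr
      obtain ⟨B', hB'1, hB'2⟩ := exists_subset_card_eq hBr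
      exact ⟨A', B', hA'1.trans sdiff_subset, hB'1, hA'2, hB'2,
        sdiff_disjoint.mono hA'1 hB'1⟩
    · obtain ⟨A', hA'1, hA'2, hA'3⟩ := exists_subsuperset_card_eq
        (sdiff_subset : A \ B ⊆ A) (not_le.1 hr).le hAr
      have hun : A ∪ B ⊆ A' ∪ (B \ A') := by
        intro v hv
        by_cases hvA : v ∈ A'
        · exact mem_union_left _ hvA
        · refine mem_union_right _ (mem_sdiff.2 ⟨?_, hvA⟩)
          by_contra hvB
          exact hvA (hA'1 (mem_sdiff.2 ⟨(mem_union.1 hv).resolve_right hvB, hvB⟩))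
      have h1 := (card_le_card hun).trans (card_union_le _ _)
      obtain ⟨B', hB'1, hB'2⟩ := exists_subset_card_eq (by omega : r ≤ (B \ A').card)
      exact ⟨A', B', hA'2, hB'1.trans sdiff_subset, hA'3, hB'2,
        disjoint_sdiff.mono_right hB'1⟩
  have eA := (A'.equivFinOfCardEq hA').symm
  have eB := (B'.equivFinOfCardEq hB').symm
  let f : Fin r ⊕ Fin r → V := Sum.elim (fun i => (eA i : V)) (fun i => (eB i : V))
  refine hfree ⟨⟨⟨f, ?_⟩, ?_⟩⟩
  · rintro (a | a) (b | b) hab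
    · have hne : a ≠ b := by simpa [twoCliques] using hab
      exact hA (hA'A (eA a).2) (hA'A (eA b).2) fun h => hne (eA.injective (Subtype.ext h))
    · simp [twoCliques] at hab
    · simp [twoCliques] at hab
    · have hne : a ≠ b := by simpa [twoCliques] using hab
      exact hB (hB'B (eB a).2) (hB'B (eB b).2) fun h => hne (eB.injective (Subtype.ext h))
  · rintro (a | a) (b | b) hab
    · exact congrArg Sum.inl (eA.injective (Subtype.ext hab))
    · have h : (eA a : V) = eB b := hab
      exact absurd (h ▸ (eB b).2) (disjoint_left.1 hdisj (eA a).2)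
    · have h : (eB a : V) = eA b := hab
      exact absurd (h ▸ (eB a).2) (disjoint_left.1 hdisj (eA b).2)
    · exact congrArg Sum.inr (eB.injective (Subtype.ext hab))

end TwoCliques

section Estimates

theorem two_pow_pred_le_factorial (s : ℕ) : 2 ^ (s - 1) ≤ s.factorial := by
  induction s with
  | zero => simp
  | succ s ih =>
    rcases s with _ | s
    · simp
    · rw [Nat.factorial_succ, Nat.add_sub_cancel, pow_succ']
      exact Nat.mul_le_mul (by omega) (by simpa using ih)

theorem sq_mul_choose_bound_lt_pow {r k s t n q : ℕ} (hr : 3 ≤ r) (hkr : k ≤ 2 * r) (hs : 1 ≤ s)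
    (hk : k = t + s) (hn : n - t < s * (q + 1)) (hq : r ^ 4 * k ^ (2 * s) < q) :
    k ^ 2 * (k.choose t * (k * (n - (t + 1)).choose (s - 1))) < q ^ s := by
  have h1 : (n - (t + 1)).choose (s - 1) ≤ (2 * (s * q)) ^ (s - 1) := by
    refine (Nat.choose_le_pow _ _).trans (Nat.pow_le_pow_left ?_ _)
    have : s * (q + 1) = s * q + s := by ring
    have : s ≤ s * q := Nat.le_mul_of_pos_right s (by omega)
    omega
  have h2 : k.choose t * 2 ^ (s - 1) ≤ k ^ s := by
    rw [hk, Nat.choose_symm_add, ← hk]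
    calc k.choose s * 2 ^ (s - 1) ≤ k.choose s * s.factorial :=
          Nat.mul_le_mul_left _ (two_pow_pred_le_factorial s)
      _ = k.descFactorial s := by rw [Nat.descFactorial_eq_factorial_mul_choose, mul_comm]
      _ ≤ k ^ s := Nat.descFactorial_le_pow k s
  have h3 : s ^ (s - 1) ≤ k ^ (s - 1) := Nat.pow_le_pow_left (by omega) _
  have h4 : k ^ 2 ≤ r ^ 4 := by nlinarith [Nat.mul_le_mul hkr hkr, Nat.mul_le_mul hr hr]
  obtain ⟨p, rfl⟩ : ∃ p, s = p + 1 := ⟨s - 1, by omega⟩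
  simp only [Nat.add_sub_cancel] at *
  calc k ^ 2 * (k.choose t * (k * (n - (t + 1)).choose p))
      ≤ k ^ 2 * (k.choose t * (k * (2 * ((p + 1) * q)) ^ p)) := by gcongr
    _ = k ^ 3 * (k.choose t * 2 ^ p) * (p + 1) ^ p * q ^ p := by
        rw [mul_pow, mul_pow]
        ring
    _ ≤ k ^ 3 * k ^ (p + 1) * k ^ p * q ^ p := by gcongr
    _ = k ^ 2 * k ^ (2 * (p + 1)) * q ^ p := by ring
    _ ≤ r ^ 4 * k ^ (2 * (p + 1)) * q ^ p := by gcongr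
    _ < q * q ^ p := by
        refine Nat.mul_lt_mul_of_pos_right hq (Nat.pow_pos (by omega))
    _ = q ^ (p + 1) := by ring

theorem mul_pow_le_threshold {r k s t : ℕ} (hr : 3 ≤ r) (ht : 1 ≤ t) (hk : k = t + s) :
    (r : ℝ) ^ 4 * (k : ℝ) ^ (2 * s) ≤
      (Real.exp 1 * (r : ℝ) ^ 4 * (k : ℝ) ^ ((k : ℝ) / 2)) ^ ((k : ℝ) / t) := by
  have ht0 : (1 : ℝ) ≤ t := by exact_mod_cast ht
  have hk1 : (1 : ℝ) ≤ k := by exact_mod_cast (by omega : 1 ≤ k)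
  have hkt : (k : ℝ) = t + s := by exact_mod_cast hk
  have hs0 : (0 : ℝ) ≤ s := Nat.cast_nonneg s
  have hr1 : (1 : ℝ) ≤ (r : ℝ) ^ 4 := one_le_pow₀ (by exact_mod_cast (by omega : 1 ≤ r))
  have he : (1 : ℝ) ≤ Real.exp 1 := Real.one_le_exp zero_le_one
  have hexp : 1 ≤ (k : ℝ) / t := by
    rw [one_le_div (by linarith)]
    linarith
  rw [Real.mul_rpow (by positivity) (by positivity)]
  refine mul_le_mul ?_ ?_ (by positivity) (by positivity)
  · calc (r : ℝ) ^ 4 ≤ Real.exp 1 * (r : ℝ) ^ 4 := le_mul_of_one_le_left (by positivity) he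
      _ ≤ _ := Real.self_le_rpow_of_one_le (one_le_mul_of_one_le_of_one_le he hr1) hexp
  · rw [← Real.rpow_mul (by linarith), ← Real.rpow_natCast]
    refine Real.rpow_le_rpow_of_exponent_le hk1 ?_
    push_cast
    rw [div_mul_div_comm, le_div_iff₀ (by linarith), hkt]
    nlinarith [sq_nonneg ((t : ℝ) - s)]

end Estimates

section Extremal

open scoped Classical

/-- The partition of the vertices of `K_t ∨ T_s(m)` into `t + s` independent sets. -/
def joinColor (t s m : ℕ) : Fin t ⊕ (Σ i : Fin s, Fin ((m + i) / s)) → Fin t ⊕ Fin s :=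
  Sum.map id Sigma.fst

theorem graphJoin_turan_adj_iff (t s m : ℕ) (a b : Fin t ⊕ (Σ i : Fin s, Fin ((m + i) / s))) :
    (graphJoin (SimpleGraph.completeGraph (Fin t)) (turan s m)).Adj a b ↔
      joinColor t s m a ≠ joinColor t s m b := by
  rcases a with a | a <;> rcases b with b | b <;> simp [graphJoin, joinColor, turan]

theorem card_joinColor_inl (t s m : ℕ) (i : Fin t)
    [DecidablePred (joinColor t s m · = Sum.inl i)] :
    (univ.filter (joinColor t s m · = Sum.inl i)).card = 1 := by
  refine card_eq_one.2 ⟨Sum.inl i, ?_⟩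
  ext v
  rw [mem_filter, mem_singleton]
  rcases v with v | v <;> simp [joinColor]

theorem card_joinColor_inr (t s m : ℕ) (j : Fin s)
    [DecidablePred (joinColor t s m · = Sum.inr j)] :
    (univ.filter (joinColor t s m · = Sum.inr j)).card = (m + j) / s := by
  have : univ.filter (joinColor t s m · = Sum.inr j) =
      (univ : Finset (Fin ((m + j) / s))).image fun x => Sum.inr ⟨j, x⟩ := by
    ext v
    rw [mem_filter, mem_image]
    rcases v with v | ⟨i, v⟩
    · simp [joinColor]
    · simp only [joinColor, mem_univ, true_and, Sum.map_inr, Sum.inr.injEq]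
      constructor
      · rintro rfl
        exact ⟨v, rfl⟩
      · rintro ⟨x, hx⟩
        exact (congrArg Sigma.fst hx).symm
  rw [this, card_image_of_injective, card_univ, Fintype.card_fin]
  intro x x' h
  simpa using h

theorem sum_turan_parts {s m : ℕ} (hs : 1 ≤ s) : ∑ i : Fin s, (m + i) / s = m := by
  have := card_turan s m hs
  rwa [Fintype.card_sigma, sum_congr rfl fun i _ => Fintype.card_fin _] at this

theorem exists_pow_eq_prod_le_cliqueSpectralRadius_join {t s m k : ℕ} (hs : 1 ≤ s)
    (hk : k = t + s) (hm : 1 ≤ m / s) :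
    ∃ L : ℝ, 0 ≤ L ∧ L ^ k = ((∏ i : Fin s, (m + i) / s : ℕ) : ℝ) ^ (k - 1) ∧
      L ≤ cliqueSpectralRadius k
        (graphJoin (SimpleGraph.completeGraph (Fin t)) (turan s m)) := by
  have hsurj : Function.Surjective (joinColor t s m) := by
    rintro (i | j)
    · exact ⟨Sum.inl i, rfl⟩
    · have : 0 < (m + j) / s := by
        rcases turan_part_eq (m := m) j.2 with h | h <;> omega
      exact ⟨Sum.inr ⟨j, ⟨0, this⟩⟩, rfl⟩
  obtain ⟨L, hL0, hL, hLle⟩ := exists_pow_eq_prod_card_le_cliqueSpectralRadius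
    (graphJoin_turan_adj_iff t s m) hsurj (k := k) (by omega) (by simp [hk])
  refine ⟨L, hL0, ?_, hLle⟩
  rw [hL, Fintype.prod_sum_type]
  simp_rw [card_joinColor_inl, card_joinColor_inr]
  simp

/-- The graphs which consist of a clique `T` joined to a complete multipartite graph with balanced
parts. -/
theorem nonempty_iso_graphJoin_turan {V : Type*} [Fintype V] {G : SimpleGraph V} {s t m : ℕ}
    {S T : Finset V} {c : V → ℕ} (hdisj : Disjoint S T) (hcover : ∀ v, v ∉ T → v ∈ S)
    (hTcard : T.card = t) (hT : G.IsClique T) (hST : ∀ v ∈ S, ∀ w ∈ T, G.Adj v w)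
    (hcs : ∀ v ∈ S, c v < s) (hc : ∀ a ∈ S, ∀ b ∈ S, G.Adj a b ↔ c a ≠ c b)
    (σ : Equiv.Perm (Fin s))
    (hσ : ∀ j : Fin s, (m + σ j) / s = (S.filter (c · = (j : ℕ))).card) :
    Nonempty (G ≃g graphJoin (SimpleGraph.completeGraph (Fin t)) (turan s m)) := by
  have eT := T.equivFinOfCardEq hTcard
  let d : V → Fin t ⊕ Fin s := fun v =>
    if h : v ∈ T then Sum.inl (eT ⟨v, h⟩) else Sum.inr (σ ⟨c v, hcs v (hcover v h)⟩)
  have hdT : ∀ v (h : v ∈ T), d v = Sum.inl (eT ⟨v, h⟩) := fun v h => dif_pos h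
  have hdS : ∀ v (h : v ∉ T), d v = Sum.inr (σ ⟨c v, hcs v (hcover v h)⟩) := fun v h => dif_neg h
  refine nonempty_iso_of_card_fiber_eq (c := d) (d := joinColor t s m) ?_
    (graphJoin_turan_adj_iff t s m) ?_
  · intro a b
    by_cases ha : a ∈ T <;> by_cases hb : b ∈ T
    · rw [hdT a ha, hdT b hb, Ne, Sum.inl.injEq, eT.injective.eq_iff, Subtype.mk.injEq]
      exact ⟨fun h => h.ne, fun h => hT ha hb h⟩
    · rw [hdT a ha, hdS b hb]
      exact iff_of_true (hST b (hcover b hb) a ha).symm (by simp)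
    · rw [hdS a ha, hdT b hb]
      exact iff_of_true (hST a (hcover a ha) b hb) (by simp)
    · rw [hdS a ha, hdS b hb, Ne, Sum.inr.injEq, σ.injective.eq_iff, Fin.mk.injEq]
      exact hc a (hcover a ha) b (hcover b hb)
  · rintro (i | j)
    · rw [card_joinColor_inl]
      refine card_eq_one.2 ⟨(eT.symm i : V), ?_⟩
      ext v
      simp only [mem_filter, mem_univ, true_and, mem_singleton]
      by_cases hv : v ∈ T
      · rw [hdT v hv, Sum.inl.injEq, ← Equiv.eq_symm_apply, Subtype.ext_iff]
      · rw [hdS v hv]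
        refine iff_of_false (by simp) ?_
        rintro rfl
        exact hv (eT.symm i).2
    · rw [card_joinColor_inr]
      have := hσ (σ.symm j)
      rw [Equiv.apply_symm_apply] at this
      rw [this]
      congr 1
      ext v
      simp only [mem_filter, mem_univ, true_and]
      by_cases hv : v ∈ T
      · rw [hdT v hv]
        exact iff_of_false (by simp) fun h => disjoint_left.1 hdisj h.1 hv
      · rw [hdS v hv, Sum.inr.injEq, ← Equiv.eq_symm_apply, Fin.ext_iff]
        exact ⟨fun h => ⟨hcover v hv, h⟩, fun h => h.2⟩

/-- The bound for the clique polynomial of a graph with `t`-intersecting `k`-cliques, together with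
the case of equality. -/
theorem cliquePoly_pow_le_of_intersecting {V : Type*} [Fintype V] {G : SimpleGraph V}
    {r k s t n : ℕ} (hr : 3 ≤ r) (hkr : k ≤ 2 * r) (hs : 1 ≤ s) (ht : 1 ≤ t) (hk : k = t + s)
    (hn : Fintype.card V = n)
    (hint : ∀ A ∈ cliquesIn G univ k, ∀ B ∈ cliquesIn G univ k, t ≤ (A ∩ B).card)
    (hq : r ^ 4 * k ^ (2 * s) < (n - t) / s) {y : V → ℝ} (hy : ∀ v, 0 ≤ y v)
    (hY : 0 < ∑ v, y v ^ k) :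
    (k * cliquePoly G univ k y) ^ k ≤
        ((∏ i : Fin s, (n - t + i) / s : ℕ) : ℝ) ^ (k - 1) * (∑ v, y v ^ k) ^ k ∧
      ((k * cliquePoly G univ k y) ^ k =
          ((∏ i : Fin s, (n - t + i) / s : ℕ) : ℝ) ^ (k - 1) * (∑ v, y v ^ k) ^ k →
        Nonempty (G ≃g graphJoin (SimpleGraph.completeGraph (Fin t)) (turan s (n - t)))) := by
  set g : Fin s → ℕ := fun i => (n - t + i) / s with hg
  set q := (n - t) / s with hqdef
  have hq1 : 1 ≤ q := by omega
  have hgq : ∀ i, g i = q ∨ g i = q + 1 := fun i => turan_part_eq i.2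
  have hgsum : ∑ i, g i = n - t := sum_turan_parts hs
  have hYk : 0 < (∑ v, y v ^ k) ^ k := pow_pos hY k
  have hk1 : k - 1 ≠ 0 := by omega
  have hτ : q ^ s ≤ ∏ i, g i := by
    have := prod_le_prod' (s := univ) (f := fun _ : Fin s => q) (g := g)
      (fun i _ => by rcases hgq i with h | h <;> omega)
    simpa using this
  have hτpos : 0 < ∏ i, g i := lt_of_lt_of_le (Nat.pow_pos hq1) hτ
  have hτpos' : (0 : ℝ) < ((∏ i, g i : ℕ) : ℝ) := by exact_mod_cast hτpos
  by_cases hT : ∃ T : Finset V, T.card = t ∧ ∀ C ∈ cliquesIn G univ k, T ⊆ C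
  · obtain ⟨T, hTcard, hT⟩ := hT
    obtain ⟨S, c, hdisj, hcs, hle, heq⟩ := cliquePoly_pow_le_of_forall_subset hy hk ht hTcard hT
    let f : Fin s → ℕ := fun j => (S.filter (c · = (j : ℕ))).card
    have hfprod : ∏ j ∈ range s, ((S.filter (c · = j)).card : ℝ) = ((∏ j, f j : ℕ) : ℝ) := by
      rw [Nat.cast_prod, prod_range]
    have hfsum : ∑ j, f j = S.card := by
      rw [card_eq_sum_card_fiberwise (f := c) (t := range s) fun v hv => by simpa using hcs v hv,
        sum_range]
    have hcardle : S.card + T.card ≤ n := by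
      rw [← card_union_of_disjoint hdisj, ← hn]
      exact card_le_univ _
    rw [hfprod] at hle heq
    obtain ⟨hfg, hfgeq⟩ := prod_le_prod_of_balanced hq1 hgq (f := f) (by omega)
    have hfg' : ((∏ j, f j : ℕ) : ℝ) ≤ ((∏ i, g i : ℕ) : ℝ) := by exact_mod_cast hfg
    refine ⟨hle.trans (mul_le_mul_of_nonneg_right
      (pow_le_pow_left₀ (Nat.cast_nonneg _) hfg' _) hYk.le), fun hE => ?_⟩
    have hPpos : 0 < cliquePoly G univ k y := by
      refine lt_of_le_of_ne (cliquePoly_nonneg hy) fun h0 => ?_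
      rw [← h0, mul_zero, zero_pow (by omega)] at hE
      exact (mul_pos (pow_pos hτpos' (k - 1)) hYk).ne hE
    have hfgE : ∏ j, f j = ∏ i, g i := by
      refine le_antisymm hfg ?_
      rw [hE] at hle
      have := le_of_mul_le_mul_right hle hYk
      have := le_of_pow_le_pow_left₀ hk1 (Nat.cast_nonneg _) this
      exact_mod_cast this
    obtain ⟨hTcl, hSadj, hSc⟩ := heq hPpos (by rw [hfgE]; exact hE)
    obtain ⟨hfq, hsumE⟩ := hfgeq hfgE
    obtain ⟨σ, hσ⟩ := exists_perm_of_balanced hfq hgq hsumE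
    have hSpos : 0 < S.card := by
      rw [← hfsum, hsumE, hgsum]
      exact Nat.pos_of_ne_zero fun h => by simp [hqdef, h] at hq1
    have hST : S ∪ T = univ := by
      refine eq_univ_of_card _ ?_
      rw [card_union_of_disjoint hdisj]
      omega
    refine nonempty_iso_graphJoin_turan hdisj (fun v hv => ?_) hTcard hTcl hSadj hcs hSc σ hσ
    exact (mem_union.1 (hST ▸ mem_univ v)).resolve_right hv
  · push Not at hT
    have hF := card_le_of_intersecting (cliquesIn G univ k)
      (fun C hC => (mem_cliquesIn.1 hC).2.1) hint hT
    rw [hn, show k - (t + 1) = s - 1 by omega] at hF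
    have hlt : n - t < s * (q + 1) := Nat.lt_mul_div_succ (n - t) hs
    have hlt2 : k ^ 2 * (cliquesIn G univ k).card < ∏ i, g i :=
      (Nat.mul_le_mul_left _ hF).trans_lt
        ((sq_mul_choose_bound_lt_pow hr hkr hs hk hlt hq).trans_le hτ)
    have hlt3 : (k : ℝ) ^ 2 * ((cliquesIn G univ k).card : ℝ) < ((∏ i, g i : ℕ) : ℝ) := by
      exact_mod_cast hlt2
    have hk1' : (1 : ℝ) ≤ k := by exact_mod_cast (by omega : 1 ≤ k)
    have hstrict : (k * cliquePoly G univ k y) ^ k <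
        ((∏ i, g i : ℕ) : ℝ) ^ (k - 1) * (∑ v, y v ^ k) ^ k := by
      calc (k * cliquePoly G univ k y) ^ k
          = (k : ℝ) ^ k * cliquePoly G univ k y ^ k := mul_pow _ _ _
        _ ≤ (k : ℝ) ^ (2 * (k - 1)) *
            (((cliquesIn G univ k).card : ℝ) ^ (k - 1) * (∑ v, y v ^ k) ^ k) :=
          mul_le_mul (pow_le_pow_right₀ hk1' (by omega)) (cliquePoly_pow_le_card hy (by omega))
            (pow_nonneg (cliquePoly_nonneg hy) k) (by positivity)
        _ = ((k : ℝ) ^ 2 * ((cliquesIn G univ k).card : ℝ)) ^ (k - 1) * (∑ v, y v ^ k) ^ k := by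
          rw [mul_pow, ← pow_mul]
          ring
        _ < _ := mul_lt_mul_of_pos_right (pow_lt_pow_left₀ hlt3 (by positivity) hk1) hYk
    exact ⟨hstrict.le, fun h => absurd h hstrict.ne⟩

theorem exists_weights_of_cliqueSpectralRadius_pos {V : Type*} [Fintype V] {G : SimpleGraph V}
    {k : ℕ} (hk : 1 ≤ k) (h : 0 < cliqueSpectralRadius k G) :
    ∃ y : V → ℝ, (∀ v, 0 ≤ y v) ∧ 0 < ∑ v, y v ^ k ∧
      cliqueSpectralRadius k G * ∑ v, y v ^ k ≤ k * cliquePoly G univ k y := by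
  obtain ⟨z, hz, hzr⟩ := exists_eigenvalue_of_cliqueSpectralRadius_pos h
  rw [← hzr]
  exact exists_weights_of_isTensorEigenvalue hk hz

theorem cliqueSpectralRadius_eq_zero {V : Type*} [Fintype V] {G : SimpleGraph V} {k : ℕ}
    (hk : 1 ≤ k) (hF : cliquesIn G univ k = ∅) : cliqueSpectralRadius k G = 0 := by
  refine le_antisymm (not_lt.1 fun hpos => ?_) (cliqueSpectralRadius_nonneg k)
  obtain ⟨y, -, hY, hle⟩ := exists_weights_of_cliqueSpectralRadius_pos hk hpos
  have : 0 < cliqueSpectralRadius k G * ∑ v, y v ^ k := mul_pos hpos hY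
  simp only [cliquePoly, hF, sum_empty, mul_zero] at hle
  linarith

theorem cliqueSpectralRadius_eq_one {V : Type*} [Fintype V] {G : SimpleGraph V} {k : ℕ}
    (hk : 1 ≤ k) {K : Finset V} (hK : cliquesIn G univ k = {K}) :
    cliqueSpectralRadius k G = 1 := by
  have h1 := one_le_cliqueSpectralRadius_of_unique hk hK
  refine le_antisymm ?_ h1
  obtain ⟨y, hy, hY, hle⟩ := exists_weights_of_cliqueSpectralRadius_pos hk (by linarith)
  have hKcard : K.card = k := (mem_cliquesIn.1 (hK ▸ mem_singleton_self K)).2.1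
  obtain ⟨S, c, -, -, hb, -⟩ := cliquePoly_pow_le_of_forall_subset (G := G) hy (k := k) (s := 0)
    (t := k)
    (by omega) hk hKcard (T := K)
    (fun C hC => by rw [hK, mem_singleton] at hC; rw [hC])
  rw [range_zero, prod_empty, one_pow, one_mul] at hb
  have h2 := le_of_pow_le_pow_left₀ (by omega) hY.le hb
  refine le_of_mul_le_mul_right ?_ hY
  linarith

theorem cliquesIn_graphJoin_turan_zero {t s m : ℕ} (hs : s = 0) :
    cliquesIn (graphJoin (SimpleGraph.completeGraph (Fin t)) (turan s m)) univ t = {univ} := by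
  subst hs
  have hcard : (univ : Finset (Fin t ⊕ (Σ i : Fin 0, Fin ((m + i) / 0)))).card = t := by simp
  ext C
  rw [mem_singleton, mem_cliquesIn]
  constructor
  · rintro ⟨-, h, -⟩
    exact eq_univ_of_card C (by rw [h, ← card_univ, hcard])
  · rintro rfl
    refine ⟨subset_rfl, hcard, ?_⟩
    rintro (a | ⟨i, -⟩) - (b | ⟨j, -⟩) - hab
    · rw [graphJoin_turan_adj_iff]
      simpa [joinColor] using hab
    · exact j.elim0
    · exact i.elim0
    · exact i.elim0

end Extremal

end CliqueSpectral

open CliqueSpectral in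
theorem corollary1p7 {V : Type*} [Fintype V] (G : SimpleGraph V) (n r k : ℕ)
    (hn : Fintype.card V = n) (hr : 3 ≤ r) (hrk : r ≤ k) (hk : k ≤ 2 * r - 1)
    (hfree : (CliqueSpectral.twoCliques r).Free G)
    (hlarge : (2 * (r : ℝ) - k - 1) *
        (Real.exp 1 * (r : ℝ) ^ 4 * (k : ℝ) ^ ((k : ℝ) / 2)) ^
          ((k : ℝ) / (2 * (k : ℝ) - 2 * r + 1)) + k ≤ (n : ℝ)) :
    CliqueSpectral.cliqueSpectralRadius k G ≤
        CliqueSpectral.cliqueSpectralRadius k (CliqueSpectral.extremalGraph n r k) ∧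
    (k = 2 * r - 1 →
      (CliqueSpectral.cliqueSpectralRadius k G =
          CliqueSpectral.cliqueSpectralRadius k (CliqueSpectral.extremalGraph n r k) ↔
        (G.cliqueSet k).ncard = 1)) ∧
    (k ≤ 2 * r - 2 →
      (CliqueSpectral.cliqueSpectralRadius k G =
          CliqueSpectral.cliqueSpectralRadius k (CliqueSpectral.extremalGraph n r k) ↔
        Nonempty (G ≃g CliqueSpectral.extremalGraph n r k))) := by
  classical
  have hint : ∀ A ∈ cliquesIn G Finset.univ k, ∀ B ∈ cliquesIn G Finset.univ k,
      2 * k - 2 * r + 1 ≤ (A ∩ B).card := by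
    intro A hA B hB
    obtain ⟨-, hAcard, hAcl⟩ := mem_cliquesIn.1 hA
    obtain ⟨-, hBcard, hBcl⟩ := mem_cliquesIn.1 hB
    have h1 := card_union_lt_of_twoCliques_free hfree hAcl hBcl (by omega) (by omega)
    have h2 := Finset.card_union_add_card_inter A B
    omega
  rcases Nat.lt_or_ge k (2 * r - 1) with hlt | hge
  · obtain ⟨t, ht⟩ : ∃ t, t = 2 * k - 2 * r + 1 := ⟨_, rfl⟩
    obtain ⟨s, hs⟩ : ∃ s, s = 2 * r - k - 1 := ⟨_, rfl⟩
    have hkts : k = t + s := by omega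
    have hs1 : 1 ≤ s := by omega
    have ht1 : 1 ≤ t := by omega
    have hsR : (2 * (r : ℝ) - k - 1) = s := by
      have : s + k + 1 = 2 * r := by omega
      have : (s : ℝ) + k + 1 = 2 * r := by exact_mod_cast this
      linarith
    have htR : (2 * (k : ℝ) - 2 * r + 1) = t := by
      have : t + 2 * r = 2 * k + 1 := by omega
      have : (t : ℝ) + 2 * r = 2 * k + 1 := by exact_mod_cast this
      linarith
    have hs0 : (0 : ℝ) < s := by exact_mod_cast hs1
    have hq : r ^ 4 * k ^ (2 * s) < (n - t) / s := by
      rw [hsR, htR] at hlarge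
      have h1 := mul_le_mul_of_nonneg_left (mul_pow_le_threshold hr ht1 hkts) hs0.le
      have h2 : (s : ℝ) * ((r : ℝ) ^ 4 * (k : ℝ) ^ (2 * s)) + k ≤ n := by linarith
      have h3 : s * (r ^ 4 * k ^ (2 * s)) + k ≤ n := by exact_mod_cast h2
      rw [← Nat.succ_le_iff, Nat.le_div_iff_mul_le hs1, Nat.succ_mul, mul_comm]
      omega
    have hbound := fun (y : V → ℝ) (hy : ∀ v, 0 ≤ y v) (hY : 0 < ∑ v, y v ^ k) =>
      cliquePoly_pow_le_of_intersecting hr (by omega) hs1 ht1 hkts hn (ht ▸ hint) hq hy hY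
    obtain ⟨L, hL0, hLk, hL⟩ := exists_pow_eq_prod_le_cliqueSpectralRadius_join (t := t)
      (m := n - t) hs1 hkts (by omega)
    subst ht hs
    change L ≤ cliqueSpectralRadius k (extremalGraph n r k) at hL
    rw [← hLk] at hbound
    have hk0 : k ≠ 0 := by omega
    have hle : cliqueSpectralRadius k G ≤ L := by
      rcases (cliqueSpectralRadius_nonneg (G := G) k).eq_or_lt with h0 | hpos
      · rwa [← h0]
      · obtain ⟨y, hy, hY, hyle⟩ :=
          exists_weights_of_cliqueSpectralRadius_pos (by omega) hpos
        have h1 := (hbound y hy hY).1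
        rw [← mul_pow] at h1
        have h2 := le_of_pow_le_pow_left₀ hk0 (by positivity) h1
        exact le_of_mul_le_mul_right (hyle.trans h2) hY
    refine ⟨hle.trans hL, fun h => by omega, fun _ => ⟨fun heq => ?_, ?_⟩⟩
    · have hLpos : 0 < L := by
        refine hL0.lt_of_ne fun h0 => ?_
        rw [← h0, zero_pow hk0] at hLk
        refine pow_ne_zero (k - 1) ?_ hLk.symm
        rw [Nat.cast_ne_zero, Finset.prod_ne_zero_iff]
        intro i _
        rcases turan_part_eq (m := n - (2 * k - 2 * r + 1)) i.2 with h | h <;> omega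
      have hLG : L = cliqueSpectralRadius k G := le_antisymm (heq ▸ hL) hle
      obtain ⟨y, hy, hY, hyle⟩ :=
        exists_weights_of_cliqueSpectralRadius_pos (by omega) (hLG ▸ hLpos)
      rw [← hLG] at hyle
      obtain ⟨h1, h2⟩ := hbound y hy hY
      refine h2 (le_antisymm h1 ?_)
      rw [← mul_pow]
      exact pow_le_pow_left₀ (by positivity) hyle k
    · rintro ⟨e⟩
      exact cliqueSpectralRadius_eq_of_iso e k
  · have hk' : k = 2 * r - 1 := by omega
    have hk1 : 1 ≤ k := by omega
    have hμ : cliqueSpectralRadius k (CliqueSpectral.extremalGraph n r k) = 1 := by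
      have hcl := cliquesIn_graphJoin_turan_zero (t := 2 * k - 2 * r + 1)
        (m := n - (2 * k - 2 * r + 1)) (by omega : 2 * r - k - 1 = 0)
      refine cliqueSpectralRadius_eq_one hk1 (K := Finset.univ) ?_
      rw [← hcl]
      unfold extremalGraph
      congr 1
      omega
    have hset : (G.cliqueSet k) = (cliquesIn G Finset.univ k : Set (Finset V)) := by
      ext C
      rw [SimpleGraph.mem_cliqueSet_iff, SimpleGraph.isNClique_iff, Finset.mem_coe, mem_cliquesIn]
      exact ⟨fun h => ⟨Finset.subset_univ _, h.2, h.1⟩, fun h => ⟨h.2.2, h.2.1⟩⟩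
    rw [hset, Set.ncard_coe_finset, hμ]
    have hcard : (cliquesIn G Finset.univ k).card ≤ 1 := by
      refine Finset.card_le_one.2 fun A hA B hB => ?_
      have h1 := hint A hA B hB
      have hAc := (mem_cliquesIn.1 hA).2.1
      have hBc := (mem_cliquesIn.1 hB).2.1
      rw [← Finset.eq_of_subset_of_card_le (Finset.inter_subset_left (s₁ := A) (s₂ := B)) (by omega)]
      exact Finset.eq_of_subset_of_card_le Finset.inter_subset_right (by omega)
    rcases Nat.le_one_iff_eq_zero_or_eq_one.1 hcard with h0 | h1
    · rw [cliqueSpectralRadius_eq_zero hk1 (Finset.card_eq_zero.1 h0), h0]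
      refine ⟨zero_le_one, fun _ => by norm_num, fun h => ?_⟩
      omega
    · obtain ⟨K, hK⟩ := Finset.card_eq_one.1 h1
      rw [cliqueSpectralRadius_eq_one hk1 hK, h1]
      refine ⟨le_rfl, fun _ => by norm_num, fun h => ?_⟩
      omega
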